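/- Let $\Bbbk$ be a field and $A$ a finite-dimensional unital associative $\Bbbk$-algebra. The dual space $A^*$ is a coalgebra, with comultiplication dual to the multiplication of $A$ (so $f(ab)=\sum f_1(a)f_2(b)$) and counit $f\mapsto f(1)$; the tensor algebra $T(A^*)$ is a bialgebra, with the comultiplication and counit that are algebra maps and extend those of $A^*$. For an algebra $R$, let $R^\circ\le R^*$ be the finite dual, the space of functionals whose kernel contains a two-sided ideal of finite codimension; it is a bialgebra (a Hopf algebra) if $R$ is one, and a bialgebra map $\varphi:R\to S$ induces a bialgebra map $\varphi^\circ:S^\circ\to R^\circ$, $f\mapsto f\circ\varphi$. Let $\iota:T(A^*)\to H_F(T(A^*))$ be the canonical map to the Hopf envelope (the universal bialgebra map from $T(A^*)$ to a Hopf algebra), and let $\pi:T(A^*)^\circ\to A\cong A^{**}$ be the algebra map that restricts functionals to $A^*\subset T(A^*)$. The cofree bialgebra $B_{cf}(A)\to A$ (respectively, the cofree Hopf algebra $H_{cf}(A)\to A$) is an algebra map from a bialgebra (Hopf algebra) through which every algebra map from a bialgebra (Hopf algebra) to $A$ factors by a unique bialgebra (Hopf algebra) map. Then: 1. $\pi:T(A^*)^\circ\to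 A$ is the cofree bialgebra on $A$. 2. $\pi\circ\iota^\circ: H_F(T(A^*))^\circ\to A$ is the cofree Hopf algebra on $A$. 3. Consequently, the canonical map $H_{cf}(A)\to B_{cf}(A)$, that is, the bialgebra map compatible with the structure maps to $A$, is the finite dual $\iota^\circ:H_F(T(A^*))^\circ\to T(A^*)^\circ$: for every cofree bialgebra $\pi_B:B\to A$, every cofree Hopf algebra $\pi_H:H\to A$ and the bialgebra map $\varphi:H\to B$ with $\pi_B\varphi=\pi_H$, there are bialgebra isomorphisms $\beta:B\cong T(A^*)^\circ$ and $\eta:H\cong H_F(T(A^*))^\circ$ with $\pi\beta=\pi_B$ and $\beta\varphi=\iota^\circ\eta$. -/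

import Mathlib

open scoped TensorProduct
open Coalgebra WithConv

universe u v w x

noncomputable section

namespace HopfDuality

section Pairing

variable {k : Type u} [Field k] {R : Type v} [Ring R] [Algebra k R]

/-- For linear maps `i : M → X^*` and `j : N → Y^*`, the induced map `M ⊗ N → (X ⊗ Y)^*`,
`m ⊗ n ↦ (x ⊗ y ↦ i(m)(x) j(n)(y))`. -/
def pairTensor {M N X Y : Type*} [AddCommGroup M] [Module k M] [AddCommGroup N] [Module k N]
    [AddCommGroup X] [Module k X] [AddCommGroup Y] [Module k Y]
    (i : M →ₗ[k] Module.Dual k X) (j : N →ₗ[k] Module.Dual k Y) :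
    M ⊗[k] N →ₗ[k] Module.Dual k (X ⊗[k] Y) :=
  TensorProduct.dualDistrib k X Y ∘ₗ TensorProduct.map i j

@[simp]
theorem pairTensor_tmul {M N X Y : Type*} [AddCommGroup M] [Module k M] [AddCommGroup N]
    [Module k N] [AddCommGroup X] [Module k X] [AddCommGroup Y] [Module k Y]
    (i : M →ₗ[k] Module.Dual k X) (j : N →ₗ[k] Module.Dual k Y) (m : M) (n : N) (x : X) (y : Y) :
    pairTensor i j (m ⊗ₜ n) (x ⊗ₜ y) = i m x * j n y := rfl

theorem pairTensor_injective {M N X Y : Type*} [AddCommGroup M] [Module k M] [AddCommGroup N]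
    [Module k N] [AddCommGroup X] [Module k X] [AddCommGroup Y] [Module k Y]
    (i : M →ₗ[k] Module.Dual k X) (j : N →ₗ[k] Module.Dual k Y)
    (hi : Function.Injective i) (hj : Function.Injective j) :
    Function.Injective (pairTensor i j) := by
  classical
  rw [injective_iff_map_eq_zero]
  intro t ht
  obtain ⟨c, rfl⟩ := (TensorProduct.equivFinsuppOfBasisRight (M := M)
    (Module.Basis.ofVectorSpace k N)).symm.surjective t
  rw [TensorProduct.equivFinsuppOfBasisRight_symm_apply] at ht
  suffices c = 0 by simp [this]
  ext a
  apply hi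
  ext x
  have hli : LinearIndependent k (fun a => j (Module.Basis.ofVectorSpace k N a)) :=
    (Module.Basis.ofVectorSpace k N).linearIndependent.map' j (LinearMap.ker_eq_bot.2 hj)
  rw [linearIndependent_iff'] at hli
  by_cases ha : a ∈ c.support
  · have := hli c.support (fun a => i (c a) x) (by
      ext y
      have h2 := LinearMap.congr_fun ht (x ⊗ₜ y)
      simpa [Finsupp.sum, LinearMap.sum_apply] using h2) a ha
    simpa using this
  · simp [Finsupp.notMem_support_iff.1 ha]

/-- If `D` is a space of linear functionals on an algebra `R` such that `m^* : R^* → (R ⊗ R)^*`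
carries `D` into `D ⊗ D`, this is the resulting map `Δ : D → D ⊗ D`, characterized by
`f(ab) = ∑ f₁(a) f₂(b)`. -/
def dualComul {D : Type*} [AddCommGroup D] [Module k D] (i : D →ₗ[k] Module.Dual k R)
    (hi : Function.Injective i)
    (hm : ∀ f, i f ∘ₗ LinearMap.mul' k R ∈ LinearMap.range (pairTensor i i)) : D →ₗ[k] D ⊗[k] D :=
  (LinearEquiv.ofInjective (pairTensor i i) (pairTensor_injective i i hi hi)).symm.toLinearMap ∘ₗ
    LinearMap.codRestrict _ ((LinearMap.mul' k R).dualMap ∘ₗ i) hm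

theorem dualComul_apply {D : Type*} [AddCommGroup D] [Module k D]
    (i : D →ₗ[k] Module.Dual k R) (hi : Function.Injective i)
    (hm : ∀ f, i f ∘ₗ LinearMap.mul' k R ∈ LinearMap.range (pairTensor i i)) (f : D) (a b : R) :
    pairTensor i i (dualComul i hi hm f) (a ⊗ₜ b) = i f (a * b) := by
  have : (LinearEquiv.ofInjective (pairTensor i i) (pairTensor_injective i i hi hi)
      (dualComul i hi hm f) : Module.Dual k (R ⊗[k] R)) = i f ∘ₗ LinearMap.mul' k R := by
    simp only [dualComul, LinearMap.comp_apply, LinearEquiv.coe_coe, LinearEquiv.apply_symm_apply]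
    rfl
  exact LinearMap.congr_fun this (a ⊗ₜ b)

/-- The coalgebra structure on a space `D` of linear functionals on an algebra `R` such that
`m^* : R^* → (R ⊗ R)^*` carries `D` into `D ⊗ D`; the counit is `ε(f) = f(1)`. -/
abbrev dualCoalgebra {D : Type*} [AddCommGroup D] [Module k D] (i : D →ₗ[k] Module.Dual k R)
    (hi : Function.Injective i)
    (hm : ∀ f, i f ∘ₗ LinearMap.mul' k R ∈ LinearMap.range (pairTensor i i)) : Coalgebra k D :=
  let Δ : D →ₗ[k] D ⊗[k] D := dualComul i hi hm
  have hΔ : ∀ f a b, pairTensor i i (Δ f) (a ⊗ₜ b) = i f (a * b) := dualComul_apply i hi hm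
  have h1 : ∀ (t : D ⊗[k] D) (a b c : R),
      pairTensor i (pairTensor i i) (TensorProduct.assoc k D D D (Δ.rTensor D t))
        (a ⊗ₜ (b ⊗ₜ c)) = pairTensor i i t ((a * b) ⊗ₜ c) := fun t a b c => by
    induction t with
    | zero => simp
    | add x y hx hy => simp only [map_add, LinearMap.add_apply, hx, hy]
    | tmul x y =>
      simp only [LinearMap.rTensor_tmul, pairTensor_tmul, ← hΔ]
      induction Δ x with
      | zero => simp
      | add x y hx hy => simp only [map_add, LinearMap.add_apply, TensorProduct.add_tmul, hx, hy,
          add_mul]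
      | tmul x z => simp [mul_assoc]
  have h2 : ∀ (t : D ⊗[k] D) (a b c : R),
      pairTensor i (pairTensor i i) (Δ.lTensor D t)
        (a ⊗ₜ (b ⊗ₜ c)) = pairTensor i i t (a ⊗ₜ (b * c)) := fun t a b c => by
    induction t with
    | zero => simp
    | add x y hx hy => simp only [map_add, LinearMap.add_apply, hx, hy]
    | tmul x y => simp only [LinearMap.lTensor_tmul, pairTensor_tmul, ← hΔ]
  let ε : D →ₗ[k] k := LinearMap.applyₗ (1 : R) ∘ₗ i
  { comul := Δ
    counit := ε
    coassoc := by
      ext f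
      apply pairTensor_injective i (pairTensor i i) hi (pairTensor_injective i i hi hi)
      ext a b c
      simp [h1, h2, hΔ, mul_assoc]
    rTensor_counit_comp_comul := by
      ext f
      apply (TensorProduct.lid k D).injective
      apply hi
      ext a
      have : ∀ t : D ⊗[k] D, i (TensorProduct.lid k D (ε.rTensor D t)) a =
          pairTensor i i t (1 ⊗ₜ a) := fun t => by
        induction t with
        | zero => simp
        | add x y hx hy => simp only [map_add, LinearMap.add_apply, hx, hy]
        | tmul x y => simp [ε]
      simp [this, hΔ]
    lTensor_counit_comp_comul := by
      ext f
      apply (TensorProduct.rid k D).injective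
      apply hi
      ext a
      have : ∀ t : D ⊗[k] D, i (TensorProduct.rid k D (ε.lTensor D t)) a =
          pairTensor i i t (a ⊗ₜ 1) := fun t => by
        induction t with
        | zero => simp
        | add x y hx hy => simp only [map_add, LinearMap.add_apply, hx, hy]
        | tmul x y => simp [ε, mul_comm]
      simp [this, hΔ] }

variable (k R)

theorem dual_mem_range [FiniteDimensional k R] (f : Module.Dual k R) :
    f ∘ₗ LinearMap.mul' k R ∈ LinearMap.range
      (pairTensor (LinearMap.id : Module.Dual k R →ₗ[k] _) LinearMap.id) := by
  refine ⟨(TensorProduct.dualDistribEquiv k R R).symm (f ∘ₗ LinearMap.mul' k R), ?_⟩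
  unfold pairTensor
  rw [TensorProduct.map_id, LinearMap.comp_id]
  exact (TensorProduct.dualDistribEquiv k R R).apply_symm_apply _

/-- The coalgebra `A^*` dual to a finite-dimensional algebra `A`. -/
instance dualInstCoalgebra [FiniteDimensional k R] : Coalgebra k (Module.Dual k R) :=
  dualCoalgebra LinearMap.id Function.injective_id (dual_mem_range k R)

variable {k R}

/-- `f(ab) = ∑ f₁(a) f₂(b)` for `f ∈ A^*`. -/
theorem dual_comul [FiniteDimensional k R] (f : Module.Dual k R) (a b : R) :
    TensorProduct.dualDistrib k R R (comul f) (a ⊗ₜ b) = f (a * b) := by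
  have := dualComul_apply (k := k) (R := R) LinearMap.id Function.injective_id
    (dual_mem_range k R) f a b
  unfold pairTensor at this
  rwa [TensorProduct.map_id, LinearMap.comp_id] at this

theorem dual_counit [FiniteDimensional k R] (f : Module.Dual k R) : counit f = f (1 : R) := rfl

end Pairing

section FiniteDual

variable (k : Type u) [Field k] (R : Type v) [Ring R] [Algebra k R]

/-- The functionals on `R` whose kernel contains a two-sided ideal of finite codimension. -/
def finiteDualSubmodule : Submodule k (Module.Dual k R) where
  carrier := {f | ∃ I : Ideal R, I.IsTwoSided ∧ FiniteDimensional k (R ⧸ I) ∧ ∀ x ∈ I, f x = 0}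
  zero_mem' := by
    refine ⟨⊤, inferInstance, ?_, by simp⟩
    have : Subsingleton (R ⧸ (⊤ : Ideal R)) := Ideal.Quotient.subsingleton_iff.2 rfl
    infer_instance
  add_mem' := by
    rintro f g ⟨I, hI, hI', hf⟩ ⟨J, hJ, hJ', hg⟩
    refine ⟨I ⊓ J, ⟨fun b ha => ⟨I.mul_mem_right b ha.1, J.mul_mem_right b ha.2⟩⟩, ?_, fun x hx => by simp [hf x hx.1, hg x hx.2]⟩
    let p : R →ₗ[k] (R ⧸ I) × (R ⧸ J) :=
      (Ideal.Quotient.mkₐ k I).toLinearMap.prod (Ideal.Quotient.mkₐ k J).toLinearMap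
    have hp : LinearMap.ker p = (I ⊓ J).restrictScalars k := by
      ext x
      simp [p, Ideal.Quotient.eq_zero_iff_mem]
    have e := p.quotKerEquivRange
    rw [hp] at e
    exact Module.Finite.equiv e.symm
  smul_mem' := by
    rintro c f ⟨I, hI, hI', hf⟩
    exact ⟨I, hI, hI', fun x hx => by simp [hf x hx]⟩

variable {k R}

theorem mem_finiteDual_of_factor {Q : Type*} [Ring Q] [Algebra k Q] [FiniteDimensional k Q]
    (p : R →ₐ[k] Q) (g : Module.Dual k Q) : g ∘ₗ p.toLinearMap ∈ finiteDualSubmodule k R := by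
  refine ⟨RingHom.ker p, inferInstance, ?_, fun x hx => ?_⟩
  · have e := p.toLinearMap.quotKerEquivRange
    exact Module.Finite.equiv (e.symm : _ ≃ₗ[k] (R ⧸ RingHom.ker p))
  · have : p x = 0 := hx
    simp [this]

theorem exists_factor {f : Module.Dual k R} (hf : f ∈ finiteDualSubmodule k R) :
    ∃ (Q : Type v) (_ : Ring Q) (_ : Algebra k Q) (_ : FiniteDimensional k Q)
      (p : R →ₐ[k] Q) (g : Module.Dual k Q), f = g ∘ₗ p.toLinearMap := by
  obtain ⟨I, hI, hI', hf⟩ := hf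
  exact ⟨R ⧸ I, inferInstance, inferInstance, hI', Ideal.Quotient.mkₐ k I,
    (I.restrictScalars k).liftQ f hf, by ext; rfl⟩

variable (k R)

/-- The finite dual `R°` of an algebra `R`. -/
def FiniteDual : Type (max u v) := finiteDualSubmodule k R

namespace FiniteDual

instance : AddCommGroup (FiniteDual k R) := inferInstanceAs (AddCommGroup (finiteDualSubmodule k R))

instance : Module k (FiniteDual k R) := inferInstanceAs (Module k (finiteDualSubmodule k R))

/-- The inclusion `R° → R^*`. -/
def incl : FiniteDual k R →ₗ[k] Module.Dual k R := (finiteDualSubmodule k R).subtype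

variable {k R}

theorem incl_injective : Function.Injective (incl k R) := Subtype.val_injective

theorem incl_mem (f : FiniteDual k R) : incl k R f ∈ finiteDualSubmodule k R := f.2

@[ext]
theorem ext {f g : FiniteDual k R} (h : ∀ a, incl k R f a = incl k R g a) : f = g :=
  incl_injective (LinearMap.ext h)

/-- An element of `R°` from a functional on `R` that lies in it. -/
def mk (f : Module.Dual k R) (hf : f ∈ finiteDualSubmodule k R) : FiniteDual k R := ⟨f, hf⟩

@[simp]
theorem incl_mk (f : Module.Dual k R) (hf : f ∈ finiteDualSubmodule k R) :
    incl k R (mk f hf) = f := rfl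

theorem comp_mem {S : Type*} [Ring S] [Algebra k S] (φ : R →ₐ[k] S) (f : FiniteDual k S) :
    incl k S f ∘ₗ φ.toLinearMap ∈ finiteDualSubmodule k R := by
  obtain ⟨Q, _, _, _, p, g, h⟩ := exists_factor (incl_mem f)
  rw [h]
  exact mem_finiteDual_of_factor (p.comp φ) g

/-- The finite dual `φ° : S° → R°`, `f ↦ f ∘ φ`, of an algebra map `φ : R → S`, as a linear map. -/
def mapₗ {S : Type*} [Ring S] [Algebra k S] (φ : R →ₐ[k] S) :
    FiniteDual k S →ₗ[k] FiniteDual k R :=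
  LinearMap.codRestrict (finiteDualSubmodule k R) (φ.toLinearMap.dualMap ∘ₗ incl k S) (comp_mem φ)

@[simp]
theorem incl_mapₗ {S : Type*} [Ring S] [Algebra k S] (φ : R →ₐ[k] S) (f : FiniteDual k S) (a : R) :
    incl k R (mapₗ φ f) a = incl k S f (φ a) := rfl

variable (k R) in
/-- The pairing of `R° ⊗ R°` with `R ⊗ R`. -/
abbrev pair : FiniteDual k R ⊗[k] FiniteDual k R →ₗ[k] Module.Dual k (R ⊗[k] R) :=
  pairTensor (incl k R) (incl k R)

theorem pair_injective : Function.Injective (pair k R) :=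
  pairTensor_injective _ _ incl_injective incl_injective

theorem mul_mem_range_pair (f : FiniteDual k R) :
    incl k R f ∘ₗ LinearMap.mul' k R ∈ LinearMap.range (pair k R) := by
  obtain ⟨Q, _, _, _, p, g, h⟩ := exists_factor (incl_mem f)
  let q : Module.Dual k Q →ₗ[k] FiniteDual k R :=
    LinearMap.codRestrict (finiteDualSubmodule k R) p.toLinearMap.dualMap
      (mem_finiteDual_of_factor p)
  refine ⟨TensorProduct.map q q (comul g), ?_⟩
  ext a b
  have : ∀ t : Module.Dual k Q ⊗[k] Module.Dual k Q, pair k R (TensorProduct.map q q t) (a ⊗ₜ b) =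
      TensorProduct.dualDistrib k Q Q t (p a ⊗ₜ p b) := fun t => by
    induction t with
    | zero => simp
    | add x y hx hy => simp only [map_add, LinearMap.add_apply, hx, hy]
    | tmul x y => rfl
  simp [this, h, dual_comul]

/-- The finite dual of an algebra is a coalgebra. -/
instance : Coalgebra k (FiniteDual k R) :=
  dualCoalgebra (incl k R) incl_injective mul_mem_range_pair

/-- `f(ab) = ∑ f₁(a) f₂(b)` for `f ∈ R°`. -/
@[simp]
theorem pair_comul (f : FiniteDual k R) (a b : R) :
    pair k R (comul f) (a ⊗ₜ b) = incl k R f (a * b) :=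
  dualComul_apply (incl k R) incl_injective mul_mem_range_pair f a b

@[simp]
theorem counit_apply (f : FiniteDual k R) : counit f = incl k R f 1 := rfl

end FiniteDual

end FiniteDual

namespace FiniteDual

section Bialgebra

variable {k : Type u} [Field k] {R : Type v} [Ring R] [Bialgebra k R]

theorem one_mem : (counit : R →ₗ[k] k) ∈ finiteDualSubmodule k R :=
  mem_finiteDual_of_factor (Bialgebra.counitAlgHom k R) LinearMap.id

theorem mul_mem (f g : FiniteDual k R) :
    (toConv (incl k R f) * toConv (incl k R g)).ofConv ∈ finiteDualSubmodule k R := by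
  obtain ⟨Q, _, _, _, p, f', hf⟩ := exists_factor (incl_mem f)
  obtain ⟨P, _, _, _, q, g', hg⟩ := exists_factor (incl_mem g)
  have := mem_finiteDual_of_factor
    ((Algebra.TensorProduct.map p q).comp (Bialgebra.comulAlgHom k R))
    (LinearMap.mul' k k ∘ₗ TensorProduct.map f' g')
  convert this using 1
  rw [hf, hg, LinearMap.convMul_def]
  ext a
  simp only [LinearMap.comp_apply, TensorProduct.map_comp]
  rfl

instance : One (FiniteDual k R) := ⟨mk counit one_mem⟩

/-- The convolution product, `(fg)(a) = ∑ f(a₁) g(a₂)`. -/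
instance : Mul (FiniteDual k R) :=
  ⟨fun f g => mk (toConv (incl k R f) * toConv (incl k R g)).ofConv (mul_mem f g)⟩

theorem incl_one (a : R) : incl k R 1 a = counit a := rfl

theorem incl_mul (f g : FiniteDual k R) (a : R) :
    incl k R (f * g) a = pair k R (f ⊗ₜ g) (comul a) := by
  change LinearMap.mul' k k (TensorProduct.map (incl k R f) (incl k R g) (comul a)) = _
  induction (comul a : R ⊗[k] R) with
  | zero => simp
  | add x y hx hy => simp only [map_add, hx, hy]
  | tmul x y => rfl

theorem incl_mul_repr (f g : FiniteDual k R) {a : R} {ι : Type*} (r : Coalgebra.Repr k a ι) :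
    incl k R (f * g) a = ∑ i ∈ r.index, incl k R f (r.left i) * incl k R g (r.right i) := by
  rw [incl_mul, ← r.eq]
  simp

/-- `R°` as a subset of the convolution algebra `R^*`. -/
def toDual (f : FiniteDual k R) : WithConv (R →ₗ[k] k) := toConv (incl k R f)

theorem toDual_injective : Function.Injective (toDual (k := k) (R := R)) :=
  fun _ _ h => incl_injective (toConv_injective h)

theorem toDual_mul (f g : FiniteDual k R) : toDual (f * g) = toDual f * toDual g := rfl

theorem toDual_one : toDual (1 : FiniteDual k R) = 1 := rfl

theorem toDual_add (f g : FiniteDual k R) : toDual (f + g) = toDual f + toDual g := rfl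

theorem toDual_zero : toDual (0 : FiniteDual k R) = 0 := rfl

theorem toDual_smul (c : k) (f : FiniteDual k R) : toDual (c • f) = c • toDual f := rfl

instance : Ring (FiniteDual k R) :=
  { (inferInstance : AddCommGroup (FiniteDual k R)),
    (inferInstance : One (FiniteDual k R)), (inferInstance : Mul (FiniteDual k R)) with
    left_distrib := fun a b c => toDual_injective (by
      simp only [toDual_mul, toDual_add, mul_add])
    right_distrib := fun a b c => toDual_injective (by
      simp only [toDual_mul, toDual_add, add_mul])
    zero_mul := fun a => toDual_injective (by simp only [toDual_mul, toDual_zero, zero_mul])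
    mul_zero := fun a => toDual_injective (by simp only [toDual_mul, toDual_zero, mul_zero])
    mul_assoc := fun a b c => toDual_injective (by simp only [toDual_mul, mul_assoc])
    one_mul := fun a => toDual_injective (by simp only [toDual_mul, toDual_one, one_mul])
    mul_one := fun a => toDual_injective (by simp only [toDual_mul, toDual_one, mul_one]) }

instance : Algebra k (FiniteDual k R) :=
  Algebra.ofModule
    (fun c f g => toDual_injective (by simp only [toDual_mul, toDual_smul, smul_mul_assoc]))
    (fun c f g => toDual_injective (by simp only [toDual_mul, toDual_smul, mul_smul_comm]))

theorem incl_algebraMap (c : k) (a : R) :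
    incl k R (algebraMap k (FiniteDual k R) c) a = c * counit a := by
  rw [Algebra.algebraMap_eq_smul_one, map_smul, LinearMap.smul_apply, incl_one, smul_eq_mul]

theorem pair_mul_repr (s t : FiniteDual k R ⊗[k] FiniteDual k R) {a b : R} {ι κ : Type*}
    (r : Coalgebra.Repr k a ι) (r' : Coalgebra.Repr k b κ) :
    pair k R (s * t) (a ⊗ₜ b) = ∑ i ∈ r.index, ∑ j ∈ r'.index,
      pair k R s (r.left i ⊗ₜ r'.left j) * pair k R t (r.right i ⊗ₜ r'.right j) := by
  induction s with
  | zero => simp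
  | add x y hx hy =>
    simp only [map_add, LinearMap.add_apply, hx, hy, add_mul, Finset.sum_add_distrib]
  | tmul f g =>
    induction t with
    | zero => simp
    | add x y hx hy =>
      simp only [map_add, LinearMap.add_apply, hx, hy, mul_add, Finset.sum_add_distrib]
    | tmul f' g' =>
      simp only [Algebra.TensorProduct.tmul_mul_tmul, pairTensor_tmul, incl_mul_repr _ _ r,
        incl_mul_repr _ _ r', Finset.sum_mul_sum]
      exact Finset.sum_congr rfl fun i _ => Finset.sum_congr rfl fun j _ => by ring

/-- The finite dual of a bialgebra is a bialgebra. -/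
instance : Bialgebra k (FiniteDual k R) :=
  Bialgebra.mk' k (FiniteDual k R)
    (by rw [counit_apply, incl_one, Bialgebra.counit_one])
    (by
      intro f g
      simp [counit_apply, incl_mul, Algebra.TensorProduct.one_def])
    (by
      apply pair_injective
      ext a b
      simp [Algebra.TensorProduct.one_def, incl_one])
    (by
      intro f g
      apply pair_injective
      ext a b
      simp only [TensorProduct.AlgebraTensorModule.curry_apply, LinearMap.restrictScalars_self,
        TensorProduct.curry_apply, pair_comul]
      rw [pair_mul_repr _ _ (ℛ k a) (ℛ k b), incl_mul_repr _ _ ((ℛ k a).mul (ℛ k b))]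
      simp [Finset.sum_product])

variable {S : Type w} [Ring S] [Bialgebra k S]

/-- The finite dual `φ° : S° → R°`, `f ↦ f ∘ φ`, of a map `φ : R → S` of bialgebras. -/
def map (φ : R →ₐc[k] S) : FiniteDual k S →ₐc[k] FiniteDual k R :=
  BialgHom.ofAlgHom
    (AlgHom.ofLinearMap (mapₗ (φ : R →ₐ[k] S))
      (by
        ext a
        simp [incl_one])
      (by
        intro f g
        ext a
        simp only [incl_mapₗ]
        rw [incl_mul_repr _ _ (ℛ k a)]
        exact incl_mul_repr _ _ ((ℛ k a).induced φ)))
    (by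
      ext f
      simp)
    (by
      ext f
      apply pair_injective
      ext a b
      have : ∀ t : FiniteDual k S ⊗[k] FiniteDual k S,
          pair k R (TensorProduct.map (mapₗ (φ : R →ₐ[k] S)) (mapₗ (φ : R →ₐ[k] S)) t) (a ⊗ₜ b) =
            pair k S t (φ a ⊗ₜ φ b) := fun t => by
        induction t with
        | zero => simp
        | add x y hx hy => simp only [map_add, LinearMap.add_apply, hx, hy]
        | tmul x y => rfl
      exact (this _).trans (by simp))

@[simp]
theorem incl_map (φ : R →ₐc[k] S) (f : FiniteDual k S) (a : R) :
    incl k R (map φ f) a = incl k S f (φ a) := rfl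

end Bialgebra

section Hopf

variable {k : Type u} [Field k] {H : Type v} [Ring H] [HopfAlgebra k H]

theorem comp_antipode_mem (f : FiniteDual k H) :
    incl k H f ∘ₗ HopfAlgebra.antipode k ∈ finiteDualSubmodule k H := by
  obtain ⟨Q, _, _, _, p, g, h⟩ := exists_factor (incl_mem f)
  have : FiniteDimensional k Qᵐᵒᵖ := Module.Finite.equiv (MulOpposite.opLinearEquiv k)
  rw [h]
  exact mem_finiteDual_of_factor ((AlgHom.op p).comp (HopfAlgebra.antipodeAlgHomOp k H))
    (g ∘ₗ (MulOpposite.opLinearEquiv k).symm.toLinearMap)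

/-- The map `f ↦ f ∘ S` of `H°`. -/
def dualAntipode : FiniteDual k H →ₗ[k] FiniteDual k H :=
  LinearMap.codRestrict (finiteDualSubmodule k H)
    ((HopfAlgebra.antipode k).dualMap ∘ₗ incl k H) comp_antipode_mem

@[simp]
theorem incl_dualAntipode (f : FiniteDual k H) (a : H) :
    incl k H (dualAntipode f) a = incl k H f (HopfAlgebra.antipode k a) := rfl

theorem incl_mul' (t : FiniteDual k H ⊗[k] FiniteDual k H) (a : H) :
    incl k H (LinearMap.mul' k _ t) a = pair k H t (comul a) := by
  induction t with
  | zero => simp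
  | add x y hx hy => simp only [map_add, LinearMap.add_apply, hx, hy]
  | tmul x y => exact incl_mul x y a

/-- The finite dual of a Hopf algebra is a Hopf algebra, with antipode `f ↦ f ∘ S`. -/
instance : HopfAlgebra k (FiniteDual k H) where
  antipode := dualAntipode
  mul_antipode_rTensor_comul := by
    ext f a
    have : ∀ (t : FiniteDual k H ⊗[k] FiniteDual k H) (x : H ⊗[k] H),
        pair k H (dualAntipode.rTensor _ t) x =
          pair k H t ((HopfAlgebra.antipode k).rTensor _ x) := fun t x => by
      induction t with
      | zero => simp
      | add x y hx hy => simp only [map_add, LinearMap.add_apply, hx, hy]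
      | tmul f g => induction x with
        | zero => simp
        | add x y hx hy => simp only [map_add, hx, hy]
        | tmul x y => rfl
    have h2 : ∀ x : H ⊗[k] H, pair k H (comul f) x = incl k H f (LinearMap.mul' k H x) :=
      fun x => by
        induction x with
        | zero => simp
        | add x y hx hy => simp only [map_add, hx, hy]
        | tmul x y => simp
    simp only [LinearMap.comp_apply, incl_mul', this, h2,
      HopfAlgebra.mul_antipode_rTensor_comul_apply, Algebra.linearMap_apply, incl_algebraMap,
      counit_apply]
    rw [Algebra.algebraMap_eq_smul_one, map_smul, smul_eq_mul, mul_comm]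
  mul_antipode_lTensor_comul := by
    ext f a
    have : ∀ (t : FiniteDual k H ⊗[k] FiniteDual k H) (x : H ⊗[k] H),
        pair k H (dualAntipode.lTensor _ t) x =
          pair k H t ((HopfAlgebra.antipode k).lTensor _ x) := fun t x => by
      induction t with
      | zero => simp
      | add x y hx hy => simp only [map_add, LinearMap.add_apply, hx, hy]
      | tmul f g => induction x with
        | zero => simp
        | add x y hx hy => simp only [map_add, hx, hy]
        | tmul x y => rfl
    have h2 : ∀ x : H ⊗[k] H, pair k H (comul f) x = incl k H f (LinearMap.mul' k H x) :=
      fun x => by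
        induction x with
        | zero => simp
        | add x y hx hy => simp only [map_add, hx, hy]
        | tmul x y => simp
    simp only [LinearMap.comp_apply, incl_mul', this, h2,
      HopfAlgebra.mul_antipode_lTensor_comul_apply, Algebra.linearMap_apply, incl_algebraMap,
      counit_apply]
    rw [Algebra.algebraMap_eq_smul_one, map_smul, smul_eq_mul, mul_comm]

end Hopf

end FiniteDual

section TensorBialgebra

variable (k : Type u) [Field k] (C : Type v) [AddCommMonoid C] [Module k C] [Coalgebra k C]

/-- The comultiplication of `T(C)`, the algebra map that extends the one of `C`. -/
def tensorComul : TensorAlgebra k C →ₐ[k] TensorAlgebra k C ⊗[k] TensorAlgebra k C :=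
  TensorAlgebra.lift k
    (TensorProduct.map (TensorAlgebra.ι k) (TensorAlgebra.ι k) ∘ₗ (comul : C →ₗ[k] C ⊗[k] C))

/-- The counit of `T(C)`, the algebra map that extends the one of `C`. -/
def tensorCounit : TensorAlgebra k C →ₐ[k] k := TensorAlgebra.lift k (counit : C →ₗ[k] k)

theorem tensorComul_ι (c : C) : tensorComul k C (TensorAlgebra.ι k c) =
    TensorProduct.map (TensorAlgebra.ι k) (TensorAlgebra.ι k) (comul c) := by
  simp [tensorComul]

theorem tensorCounit_ι (c : C) : tensorCounit k C (TensorAlgebra.ι k c) = counit c := by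
  simp [tensorCounit]

/-- The tensor algebra of a coalgebra `C`, with the bialgebra structure for which `C → T(C)` is a
map of coalgebras. -/
instance tensorInstBialgebra : Bialgebra k (TensorAlgebra k C) :=
  Bialgebra.ofAlgHom (tensorComul k C) (tensorCounit k C)
    (by
      ext c
      have h1 : ∀ t : C ⊗[k] C, Algebra.TensorProduct.map (tensorComul k C) (AlgHom.id k _)
          (TensorProduct.map (TensorAlgebra.ι k) (TensorAlgebra.ι k) t) =
          TensorProduct.map (TensorProduct.map (TensorAlgebra.ι k) (TensorAlgebra.ι k))
            (TensorAlgebra.ι k) (comul.rTensor C t) := fun t => by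
        induction t with
        | zero => simp
        | add x y hx hy => simp only [map_add, hx, hy]
        | tmul x y => simp [tensorComul_ι]
      have h2 : ∀ t : C ⊗[k] C, Algebra.TensorProduct.map (AlgHom.id k _) (tensorComul k C)
          (TensorProduct.map (TensorAlgebra.ι k) (TensorAlgebra.ι k) t) =
          TensorProduct.map (TensorAlgebra.ι k)
            (TensorProduct.map (TensorAlgebra.ι k) (TensorAlgebra.ι k)) (comul.lTensor C t) :=
        fun t => by
        induction t with
        | zero => simp
        | add x y hx hy => simp only [map_add, hx, hy]
        | tmul x y => simp [tensorComul_ι]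
      have h3 : ∀ t : (C ⊗[k] C) ⊗[k] C, TensorProduct.assoc k _ _ _
          (TensorProduct.map (TensorProduct.map (TensorAlgebra.ι k) (TensorAlgebra.ι k))
            (TensorAlgebra.ι k) t) = TensorProduct.map (TensorAlgebra.ι k)
            (TensorProduct.map (TensorAlgebra.ι k) (TensorAlgebra.ι k))
            (TensorProduct.assoc k C C C t) :=
        fun t => (TensorProduct.map_map_assoc _ _ _ t).symm
      simp only [AlgHom.toLinearMap_apply, AlgHom.comp_apply, LinearMap.comp_apply,
        tensorComul_ι, h1, h2]
      exact (h3 _).trans (by rw [Coalgebra.coassoc_apply]))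
    (by
      ext c
      have h1 : ∀ t : C ⊗[k] C, Algebra.TensorProduct.map (tensorCounit k C) (AlgHom.id k _)
          (TensorProduct.map (TensorAlgebra.ι k) (TensorAlgebra.ι k) t) =
          TensorProduct.map LinearMap.id (TensorAlgebra.ι k) (counit.rTensor C t) := fun t => by
        induction t with
        | zero => simp
        | add x y hx hy => simp only [map_add, hx, hy]
        | tmul x y => simp [tensorCounit_ι]
      refine (congrArg _ (tensorComul_ι k C c)).trans ((h1 _).trans ?_)
      simp)
    (by
      ext c
      have h1 : ∀ t : C ⊗[k] C, Algebra.TensorProduct.map (AlgHom.id k _) (tensorCounit k C)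
          (TensorProduct.map (TensorAlgebra.ι k) (TensorAlgebra.ι k) t) =
          TensorProduct.map (TensorAlgebra.ι k) LinearMap.id (counit.lTensor C t) := fun t => by
        induction t with
        | zero => simp
        | add x y hx hy => simp only [map_add, hx, hy]
        | tmul x y => simp [tensorCounit_ι]
      refine (congrArg _ (tensorComul_ι k C c)).trans ((h1 _).trans ?_)
      simp)

@[simp]
theorem tensor_comul_ι (c : C) : comul (R := k) (TensorAlgebra.ι k c) =
    TensorProduct.map (TensorAlgebra.ι k) (TensorAlgebra.ι k) (comul c) :=
  tensorComul_ι k C c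

@[simp]
theorem tensor_counit_ι (c : C) : counit (R := k) (TensorAlgebra.ι k c) = counit c :=
  tensorCounit_ι k C c

end TensorBialgebra

section DualTensor

variable (k : Type u) [Field k] (A : Type v) [Ring A] [Algebra k A] [FiniteDimensional k A]

/-- The structure map `T(A^*)° → A`: the restriction of a functional on `T(A^*)` to `A^*` is an
element of `A^{**} = A`. -/
def dualTensorEvalₗ : FiniteDual k (TensorAlgebra k (Module.Dual k A)) →ₗ[k] A :=
  (Module.evalEquiv k A).symm.toLinearMap ∘ₗ (TensorAlgebra.ι k).dualMap ∘ₗ FiniteDual.incl k _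

theorem dualTensorEvalₗ_spec (f : FiniteDual k (TensorAlgebra k (Module.Dual k A)))
    (θ : Module.Dual k A) :
    θ (dualTensorEvalₗ k A f) = FiniteDual.incl k _ f (TensorAlgebra.ι k θ) := by
  change θ ((Module.evalEquiv k A).symm _) = _
  rw [Module.apply_evalEquiv_symm_apply]
  rfl

/-- The structure map `T(A^*)° → A` is a map of algebras. -/
def dualTensorEval : FiniteDual k (TensorAlgebra k (Module.Dual k A)) →ₐ[k] A :=
  AlgHom.ofLinearMap (dualTensorEvalₗ k A)
    (by
      refine sub_eq_zero.1 ((Module.forall_dual_apply_eq_zero_iff k _).1 fun θ => ?_)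
      rw [map_sub, dualTensorEvalₗ_spec, FiniteDual.incl_one, tensor_counit_ι, dual_counit,
        sub_self])
    (by
      intro f g
      refine sub_eq_zero.1 ((Module.forall_dual_apply_eq_zero_iff k _).1 fun θ => ?_)
      rw [map_sub, dualTensorEvalₗ_spec, FiniteDual.incl_mul, tensor_comul_ι, ← dual_comul,
        sub_eq_zero]
      induction (comul θ : Module.Dual k A ⊗[k] Module.Dual k A) with
      | zero => simp
      | add x y hx hy => simp only [map_add, LinearMap.add_apply, hx, hy]
      | tmul x y => simp [dualTensorEvalₗ_spec])

/-- The structure map `T(A^*)° → A` is characterized by `θ(π(f)) = f(θ)` for `θ ∈ A^*`. -/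
theorem dualTensorEval_spec (f : FiniteDual k (TensorAlgebra k (Module.Dual k A)))
    (θ : Module.Dual k A) :
    θ (dualTensorEval k A f) = FiniteDual.incl k _ f (TensorAlgebra.ι k θ) :=
  dualTensorEvalₗ_spec k A f θ

end DualTensor

section Twist

variable {k : Type u} [Field k]

/-- The coopposite coalgebra: the comultiplication is followed by the flip `x ⊗ y ↦ y ⊗ x`. -/
abbrev copCoalgebra {C : Type v} [AddCommGroup C] [Module k C] (c : Coalgebra k C) :
    Coalgebra k C where
  comul := (TensorProduct.comm k C C).toLinearMap ∘ₗ c.comul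
  counit := c.counit
  coassoc := by
    ext x
    let rev : C ⊗[k] (C ⊗[k] C) →ₗ[k] C ⊗[k] (C ⊗[k] C) :=
      (TensorProduct.leftComm k C C C).toLinearMap ∘ₗ (TensorProduct.assoc k C C C).toLinearMap ∘ₗ
        (TensorProduct.comm k C (C ⊗[k] C)).toLinearMap
    have hrev : ∀ a b c : C, rev (a ⊗ₜ (b ⊗ₜ c)) = c ⊗ₜ (b ⊗ₜ a) := fun a b c => by simp [rev]
    have h1 : ∀ t : C ⊗[k] C, TensorProduct.assoc k C C C
        (((TensorProduct.comm k C C).toLinearMap ∘ₗ c.comul).rTensor C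
          (TensorProduct.comm k C C t)) =
        rev (c.comul.lTensor C t) :=
      fun t => by
      induction t with
      | zero => simp
      | add x y hx hy => simp only [map_add, hx, hy]
      | tmul x y =>
        simp only [TensorProduct.comm_tmul, LinearMap.rTensor_tmul, LinearMap.lTensor_tmul,
          LinearMap.comp_apply, LinearEquiv.coe_coe]
        induction c.comul y with
        | zero => simp
        | add x y hx hy =>
          simp only [map_add, TensorProduct.add_tmul, TensorProduct.tmul_add, hx, hy]
        | tmul y z => simp [hrev]
    have h2 : ∀ t : C ⊗[k] C,
        ((TensorProduct.comm k C C).toLinearMap ∘ₗ c.comul).lTensor C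
          (TensorProduct.comm k C C t) =
        rev (TensorProduct.assoc k C C C (c.comul.rTensor C t)) :=
      fun t => by
      induction t with
      | zero => simp
      | add x y hx hy => simp only [map_add, hx, hy]
      | tmul x y =>
        simp only [TensorProduct.comm_tmul, LinearMap.rTensor_tmul, LinearMap.lTensor_tmul,
          LinearMap.comp_apply, LinearEquiv.coe_coe]
        induction c.comul x with
        | zero => simp
        | add x y hx hy =>
          simp only [map_add, TensorProduct.add_tmul, TensorProduct.tmul_add, hx, hy]
        | tmul x z => simp [hrev]
    exact (h1 _).trans (Eq.trans (by rw [c.coassoc_apply]) (h2 _).symm)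
  rTensor_counit_comp_comul := by
    ext x
    have : ∀ t : C ⊗[k] C, c.counit.rTensor C (TensorProduct.comm k C C t) =
        TensorProduct.comm k _ _ (c.counit.lTensor C t) := fun t => by
      induction t with
      | zero => simp
      | add x y hx hy => simp only [map_add, hx, hy]
      | tmul x y => rfl
    exact (this _).trans (by rw [c.lTensor_counit_comul]; rfl)
  lTensor_counit_comp_comul := by
    ext x
    have : ∀ t : C ⊗[k] C, c.counit.lTensor C (TensorProduct.comm k C C t) =
        TensorProduct.comm k _ _ (c.counit.rTensor C t) := fun t => by
      induction t with
      | zero => simp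
      | add x y hx hy => simp only [map_add, hx, hy]
      | tmul x y => rfl
    exact (this _).trans (by rw [c.rTensor_counit_comul]; rfl)

/-- `f * g = 1` in the convolution algebra of linear maps from a coalgebra to an algebra. -/
def ConvOne {C : Type v} [AddCommGroup C] [Module k C] (c : Coalgebra k C)
    {X : Type w} [Ring X] [Algebra k X] (f g : C →ₗ[k] X) : Prop :=
  ∀ b, LinearMap.mul' k X (TensorProduct.map f g (c.comul b)) = algebraMap k X (c.counit b)

theorem convOne_iff {C : Type v} [AddCommGroup C] [Module k C] [c : Coalgebra k C]
    {X : Type w} [Ring X] [Algebra k X] (f g : C →ₗ[k] X) :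
    ConvOne c f g ↔ toConv f * toConv g = 1 := by
  constructor
  · intro h
    ext b
    exact h b
  · intro h b
    exact congrArg (fun u : WithConv (C →ₗ[k] X) => u.ofConv b) h

section

variable {C : Type v} [AddCommGroup C] [Module k C] [c : Coalgebra k C]
  {X : Type w} [Ring X] [Algebra k X]

theorem map_comul_eq (f : C →ₗ[k] X) :
    toConv (TensorProduct.map f f ∘ₗ (comul : C →ₗ[k] C ⊗[k] C)) =
      toConv ((Algebra.TensorProduct.includeLeft : X →ₐ[k] X ⊗[k] X).toLinearMap ∘ₗ f) *
      toConv ((Algebra.TensorProduct.includeRight : X →ₐ[k] X ⊗[k] X).toLinearMap ∘ₗ f) := by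
  ext a
  rw [(ℛ k a).convMul_apply]
  change TensorProduct.map f f (comul a) = _
  rw [← (ℛ k a).eq]
  simp

theorem map_comm_comul_eq (g : C →ₗ[k] X) :
    toConv (TensorProduct.map g g ∘ₗ (copCoalgebra c).comul) =
      toConv ((Algebra.TensorProduct.includeRight : X →ₐ[k] X ⊗[k] X).toLinearMap ∘ₗ g) *
      toConv ((Algebra.TensorProduct.includeLeft : X →ₐ[k] X ⊗[k] X).toLinearMap ∘ₗ g) := by
  ext a
  rw [(ℛ k a).convMul_apply]
  change TensorProduct.map g g (TensorProduct.comm k C C (comul a)) = _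
  rw [← (ℛ k a).eq]
  simp

theorem algHom_convOne {Y : Type*} [Ring Y] [Algebra k Y] (h : X →ₐ[k] Y)
    {f g : C →ₗ[k] X} (H : toConv f * toConv g = 1) :
    toConv (h.toLinearMap ∘ₗ f) * toConv (h.toLinearMap ∘ₗ g) = 1 := by
  apply ofConv_injective
  have := LinearMap.algHom_comp_convMul_distrib h (toConv f) (toConv g)
  refine this.symm.trans ?_
  rw [H]
  ext
  simp

theorem convOne_comul {f g : C →ₗ[k] X} (H : ConvOne c f g) :
    ConvOne c (TensorProduct.map f f ∘ₗ c.comul)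
      (TensorProduct.map g g ∘ₗ (copCoalgebra c).comul) := by
  rw [convOne_iff] at *
  refine (congrArg₂ (· * ·) (map_comul_eq f) (map_comm_comul_eq g)).trans ?_
  rw [mul_assoc, ← mul_assoc _ _ (toConv (_ ∘ₗ g)), algHom_convOne _ H, one_mul,
    algHom_convOne _ H]

theorem convOne_comul' {f g : C →ₗ[k] X} (H : ConvOne c g f) :
    ConvOne c (TensorProduct.map g g ∘ₗ (copCoalgebra c).comul)
      (TensorProduct.map f f ∘ₗ c.comul) := by
  rw [convOne_iff] at *
  refine (congrArg₂ (· * ·) (map_comm_comul_eq g) (map_comul_eq f)).trans ?_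
  rw [mul_assoc, ← mul_assoc _ _ (toConv (_ ∘ₗ f)), algHom_convOne _ H, one_mul,
    algHom_convOne _ H]

end

end Twist

section Envelope

variable (k : Type u) [Field k] (B : Type v) [Ring B] [Bialgebra k B]

/-- The coalgebra structure of the `n`-th copy of `B`: that of `B` for `n` even, that of `B^{cop}`
for `n` odd. -/
abbrev twistedCoalgebra : ℕ → Coalgebra k B
  | 0 => inferInstance
  | n + 1 => copCoalgebra (twistedCoalgebra n)

/-- The multiplication of the `n`-th copy of `B`: that of `B` for `n` even, that of `B^{op}`
for `n` odd. -/
def twistedMul : ℕ → B →ₗ[k] B →ₗ[k] B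
  | 0 => LinearMap.mul k B
  | n + 1 => (twistedMul n).flip

theorem twisted_counit (n : ℕ) : (twistedCoalgebra k B n).counit = (counit : B →ₗ[k] k) := by
  induction n with
  | zero => rfl
  | succ n ih => exact ih

theorem twisted_comul_succ (n : ℕ) (b : B) : (twistedCoalgebra k B (n + 1)).comul b =
    TensorProduct.comm k B B ((twistedCoalgebra k B n).comul b) := rfl

theorem twisted_comul_one (n : ℕ) : (twistedCoalgebra k B n).comul (1 : B) = 1 := by
  induction n with
  | zero => exact Bialgebra.comul_one
  | succ n ih => rw [twisted_comul_succ, ih]; rfl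

theorem twisted_counit_mul (n : ℕ) (a b : B) :
    counit (R := k) (twistedMul k B n a b) = counit (R := k) a * counit (R := k) b := by
  induction n generalizing a b with
  | zero => exact Bialgebra.counit_mul a b
  | succ n ih => exact (ih b a).trans (mul_comm _ _)

theorem twisted_comul_mul (n : ℕ) (a b : B) :
    (twistedCoalgebra k B n).comul (twistedMul k B n a b) =
      TensorProduct.map₂ (twistedMul k B n) (twistedMul k B n)
        ((twistedCoalgebra k B n).comul a) ((twistedCoalgebra k B n).comul b) := by
  induction n generalizing a b with
  | zero =>
    have h : ∀ s t : B ⊗[k] B,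
        TensorProduct.map₂ (LinearMap.mul k B) (LinearMap.mul k B) s t = s * t := fun s t => by
      induction s with
      | zero => simp
      | add x y hx hy => simp only [map_add, LinearMap.add_apply, hx, hy, add_mul]
      | tmul x y =>
        induction t with
        | zero => simp
        | add x y hx hy => simp only [map_add, hx, hy, mul_add]
        | tmul x y => simp
    exact (Bialgebra.comul_mul a b).trans (h _ _).symm
  | succ n ih =>
    have h : ∀ s t : B ⊗[k] B, TensorProduct.comm k B B
        (TensorProduct.map₂ (twistedMul k B n) (twistedMul k B n) s t) =
        TensorProduct.map₂ (twistedMul k B (n + 1)) (twistedMul k B (n + 1))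
          (TensorProduct.comm k B B t) (TensorProduct.comm k B B s) := fun s t => by
      induction s with
      | zero => simp
      | add x y hx hy => simp only [map_add, LinearMap.add_apply, hx, hy]
      | tmul x y =>
        induction t with
        | zero => simp
        | add x y hx hy => simp only [map_add, LinearMap.add_apply, hx, hy]
        | tmul x y => simp [twistedMul]
    rw [twisted_comul_succ, twisted_comul_succ, twisted_comul_succ, ← h]
    exact congrArg _ (ih b a)

/-- The `n`-th copy of `B` in the free algebra (over `k`) on `⨁ₙ B`. -/
def envelopeGen (n : ℕ) : B →ₗ[k] TensorAlgebra k (ℕ →₀ B) :=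
  TensorAlgebra.ι k ∘ₗ Finsupp.lsingle n

/-- The relations of the Hopf envelope. Writing `b⁽ⁿ⁾` for the image of `b` in the `n`-th copy of
`B`, they say that `b ↦ b⁽ⁿ⁾` is multiplicative for `n` even, antimultiplicative for `n` odd, and
that the `(n+1)`-st copy is the image of the `n`-th copy under an antipode. -/
inductive EnvelopeRel : TensorAlgebra k (ℕ →₀ B) → TensorAlgebra k (ℕ →₀ B) → Prop
  | one (n : ℕ) : EnvelopeRel (envelopeGen k B n 1) 1
  | mul (n : ℕ) (a b : B) : EnvelopeRel (envelopeGen k B n (twistedMul k B n a b))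
      (envelopeGen k B n a * envelopeGen k B n b)
  | antipode_left (n : ℕ) (b : B) : EnvelopeRel
      (LinearMap.mul' k _ (TensorProduct.map (envelopeGen k B (n + 1)) (envelopeGen k B n)
        ((twistedCoalgebra k B n).comul b))) (algebraMap k _ (counit b))
  | antipode_right (n : ℕ) (b : B) : EnvelopeRel
      (LinearMap.mul' k _ (TensorProduct.map (envelopeGen k B n) (envelopeGen k B (n + 1))
        ((twistedCoalgebra k B n).comul b))) (algebraMap k _ (counit b))

/-- The Hopf envelope of a bialgebra `B`, that is, the free Hopf algebra on `B`. -/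
def HopfEnvelope : Type (max u v) := RingQuot (EnvelopeRel k B)

namespace HopfEnvelope

instance : Ring (HopfEnvelope k B) := inferInstanceAs (Ring (RingQuot (EnvelopeRel k B)))

instance : Algebra k (HopfEnvelope k B) :=
  inferInstanceAs (Algebra k (RingQuot (EnvelopeRel k B)))

/-- The quotient map onto the Hopf envelope. -/
def proj : TensorAlgebra k (ℕ →₀ B) →ₐ[k] HopfEnvelope k B := RingQuot.mkAlgHom k (EnvelopeRel k B)

/-- The map `b ↦ b⁽ⁿ⁾`. -/
def gen (n : ℕ) : B →ₗ[k] HopfEnvelope k B := (proj k B).toLinearMap ∘ₗ envelopeGen k B n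

variable {k B} in
/-- The relations of the Hopf envelope, for a sequence of linear maps to an algebra. -/
structure IsFamily {X : Type w} [Ring X] [Algebra k X] (φ : ℕ → B →ₗ[k] X) : Prop where
  one : ∀ n, φ n 1 = 1
  mul : ∀ n a b, φ n (twistedMul k B n a b) = φ n a * φ n b
  left : ∀ n, ConvOne (twistedCoalgebra k B n) (φ (n + 1)) (φ n)
  right : ∀ n, ConvOne (twistedCoalgebra k B n) (φ n) (φ (n + 1))

theorem algHom_mul'_map {X Y M : Type*} [Ring X] [Algebra k X] [Ring Y] [Algebra k Y]
    [AddCommGroup M] [Module k M] (h : X →ₐ[k] Y) (f g : M →ₗ[k] X) (t : M ⊗[k] M) :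
    h (LinearMap.mul' k X (TensorProduct.map f g t)) =
      LinearMap.mul' k Y (TensorProduct.map (h.toLinearMap ∘ₗ f) (h.toLinearMap ∘ₗ g) t) := by
  induction t with
  | zero => simp
  | add x y hx hy => simp only [map_add, hx, hy]
  | tmul x y => simp

theorem isFamily_gen : IsFamily (gen k B) where
  one n := (RingQuot.mkAlgHom_rel k (EnvelopeRel.one n)).trans (map_one (proj k B))
  mul n a b := (RingQuot.mkAlgHom_rel k (EnvelopeRel.mul n a b)).trans (map_mul (proj k B) _ _)
  left n b := by
    rw [twisted_counit]
    refine (algHom_mul'_map k (proj k B) _ _ _).symm.trans ?_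
    exact (RingQuot.mkAlgHom_rel k (EnvelopeRel.antipode_left n b)).trans
      ((proj k B).commutes _)
  right n b := by
    rw [twisted_counit]
    refine (algHom_mul'_map k (proj k B) _ _ _).symm.trans ?_
    exact (RingQuot.mkAlgHom_rel k (EnvelopeRel.antipode_right n b)).trans
      ((proj k B).commutes _)

variable {k B}

/-- The algebra map from the Hopf envelope given by a sequence that satisfies its relations. -/
def liftFamily {X : Type w} [Ring X] [Algebra k X] (φ : ℕ → B →ₗ[k] X) (h : IsFamily φ) :
    HopfEnvelope k B →ₐ[k] X :=
  RingQuot.liftAlgHom k ⟨TensorAlgebra.lift k (Finsupp.lsum k φ), by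
    have h0 : ∀ n b, TensorAlgebra.lift k (Finsupp.lsum k φ) (envelopeGen k B n b) = φ n b :=
      fun n b => by simp [envelopeGen]
    have h1 : ∀ n, (TensorAlgebra.lift k (Finsupp.lsum k φ)).toLinearMap ∘ₗ envelopeGen k B n =
      φ n := fun n => LinearMap.ext (h0 n)
    intro x y r
    induction r with
    | one n => rw [h0, h.one, map_one]
    | mul n a b => rw [h0, h.mul, map_mul, h0, h0]
    | antipode_left n b =>
      rw [algHom_mul'_map, h1, h1, h.left n b, AlgHom.commutes, twisted_counit]
    | antipode_right n b =>
      rw [algHom_mul'_map, h1, h1, h.right n b, AlgHom.commutes, twisted_counit]⟩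

@[simp]
theorem liftFamily_gen {X : Type w} [Ring X] [Algebra k X] (φ : ℕ → B →ₗ[k] X) (h : IsFamily φ)
    (n : ℕ) (b : B) : liftFamily φ h (gen k B n b) = φ n b := by
  refine (RingQuot.liftAlgHom_mkAlgHom_apply k _ _ _).trans ?_
  simp [envelopeGen]

theorem hom_ext {X : Type w} [Ring X] [Algebra k X] {f g : HopfEnvelope k B →ₐ[k] X}
    (h : ∀ n b, f (gen k B n b) = g (gen k B n b)) : f = g := by
  refine RingQuot.ringQuot_ext' k f g ?_
  ext n b
  exact h n b

theorem induction {P : HopfEnvelope k B → Prop} (hk : ∀ c, P (algebraMap k _ c))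
    (hg : ∀ n b, P (gen k B n b)) (ha : ∀ x y, P x → P y → P (x + y))
    (hm : ∀ x y, P x → P y → P (x * y)) (x : HopfEnvelope k B) : P x := by
  obtain ⟨y, rfl⟩ := RingQuot.mkAlgHom_surjective k (EnvelopeRel k B) x
  change P (proj k B y)
  induction y using TensorAlgebra.induction with
  | algebraMap c => rw [AlgHom.commutes]; exact hk c
  | ι z =>
    induction z using Finsupp.induction_linear with
    | zero => simpa using hk 0
    | add x y hx hy => rw [map_add, map_add]; exact ha _ _ hx hy
    | single n b => exact hg n b
  | mul x y hx hy => rw [map_mul]; exact hm _ _ hx hy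
  | add x y hx hy => rw [map_add]; exact ha _ _ hx hy

variable (k B)

theorem isFamily_comul : IsFamily (fun n =>
    TensorProduct.map (gen k B n) (gen k B n) ∘ₗ (twistedCoalgebra k B n).comul) where
  one n := by
    rw [LinearMap.comp_apply, twisted_comul_one, Algebra.TensorProduct.one_def,
      TensorProduct.map_tmul, (isFamily_gen k B).one]
    rfl
  mul n a b := by
    have h : ∀ s t : B ⊗[k] B, TensorProduct.map (gen k B n) (gen k B n)
        (TensorProduct.map₂ (twistedMul k B n) (twistedMul k B n) s t) =
        TensorProduct.map (gen k B n) (gen k B n) s *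
          TensorProduct.map (gen k B n) (gen k B n) t := fun s t => by
      induction s with
      | zero => simp
      | add x y hx hy => simp only [map_add, LinearMap.add_apply, hx, hy, add_mul]
      | tmul x y =>
        induction t with
        | zero => simp
        | add x y hx hy => simp only [map_add, hx, hy, mul_add]
        | tmul x y => simp [(isFamily_gen k B).mul]
    simp only [LinearMap.comp_apply]
    rw [twisted_comul_mul, h]
  left n := convOne_comul' (c := twistedCoalgebra k B n) ((isFamily_gen k B).left n)
  right n := convOne_comul (c := twistedCoalgebra k B n) ((isFamily_gen k B).right n)

theorem isFamily_counit : IsFamily (fun _ => (counit : B →ₗ[k] k)) where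
  one n := Bialgebra.counit_one
  mul n a b := twisted_counit_mul k B n a b
  left n b := by
    have h : ∀ t : B ⊗[k] B, LinearMap.mul' k k (TensorProduct.map counit counit t) =
      counit (R := k) (TensorProduct.lid k B ((counit : B →ₗ[k] k).rTensor B t)) := fun t => by
        induction t with
        | zero => simp
        | add x y hx hy => simp only [map_add, hx, hy]
        | tmul x y => simp
    rw [h, ← twisted_counit k B n, (twistedCoalgebra k B n).rTensor_counit_comul]
    simp
  right n b := by
    have h : ∀ t : B ⊗[k] B, LinearMap.mul' k k (TensorProduct.map counit counit t) =
      counit (R := k) (TensorProduct.lid k B ((counit : B →ₗ[k] k).rTensor B t)) := fun t => by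
        induction t with
        | zero => simp
        | add x y hx hy => simp only [map_add, hx, hy]
        | tmul x y => simp
    rw [h, ← twisted_counit k B n, (twistedCoalgebra k B n).rTensor_counit_comul]
    simp

/-- `Δ(b⁽ⁿ⁾) = ∑ b₁⁽ⁿ⁾ ⊗ b₂⁽ⁿ⁾` for `n` even, `Δ(b⁽ⁿ⁾) = ∑ b₂⁽ⁿ⁾ ⊗ b₁⁽ⁿ⁾` for `n` odd. -/
def envComul : HopfEnvelope k B →ₐ[k] HopfEnvelope k B ⊗[k] HopfEnvelope k B :=
  liftFamily _ (isFamily_comul k B)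

/-- `ε(b⁽ⁿ⁾) = ε(b)`. -/
def envCounit : HopfEnvelope k B →ₐ[k] k := liftFamily _ (isFamily_counit k B)

theorem envComul_gen (n : ℕ) (b : B) : envComul k B (gen k B n b) =
    TensorProduct.map (gen k B n) (gen k B n) ((twistedCoalgebra k B n).comul b) :=
  liftFamily_gen _ _ n b

theorem envCounit_gen (n : ℕ) (b : B) : envCounit k B (gen k B n b) = counit b :=
  liftFamily_gen _ (isFamily_counit k B) n b

instance : Bialgebra k (HopfEnvelope k B) :=
  Bialgebra.ofAlgHom (envComul k B) (envCounit k B)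
    (by
      refine hom_ext fun n b => ?_
      have h1 : ∀ t : B ⊗[k] B, Algebra.TensorProduct.map (envComul k B) (AlgHom.id k _)
          (TensorProduct.map (gen k B n) (gen k B n) t) =
          TensorProduct.map (TensorProduct.map (gen k B n) (gen k B n))
            (gen k B n) ((twistedCoalgebra k B n).comul.rTensor B t) := fun t => by
        induction t with
        | zero => simp
        | add x y hx hy => simp only [map_add, hx, hy]
        | tmul x y => simp [envComul_gen]
      have h2 : ∀ t : B ⊗[k] B, Algebra.TensorProduct.map (AlgHom.id k _) (envComul k B)
          (TensorProduct.map (gen k B n) (gen k B n) t) =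
          TensorProduct.map (gen k B n) (TensorProduct.map (gen k B n) (gen k B n))
            ((twistedCoalgebra k B n).comul.lTensor B t) := fun t => by
        induction t with
        | zero => simp
        | add x y hx hy => simp only [map_add, hx, hy]
        | tmul x y => simp [envComul_gen]
      simp only [AlgHom.comp_apply, envComul_gen, h1, h2]
      refine (TensorProduct.map_map_assoc _ _ _ _).symm.trans ?_
      rw [(twistedCoalgebra k B n).coassoc_apply])
    (by
      refine hom_ext fun n b => ?_
      have h1 : ∀ t : B ⊗[k] B, Algebra.TensorProduct.map (envCounit k B) (AlgHom.id k _)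
          (TensorProduct.map (gen k B n) (gen k B n) t) =
          TensorProduct.map LinearMap.id (gen k B n)
            ((counit : B →ₗ[k] k).rTensor B t) := fun t => by
        induction t with
        | zero => simp
        | add x y hx hy => simp only [map_add, hx, hy]
        | tmul x y => simp [envCounit_gen]
      refine (congrArg _ (envComul_gen k B n b)).trans ((h1 _).trans ?_)
      rw [← twisted_counit k B n, (twistedCoalgebra k B n).rTensor_counit_comul]
      simp)
    (by
      refine hom_ext fun n b => ?_
      have h1 : ∀ t : B ⊗[k] B, Algebra.TensorProduct.map (AlgHom.id k _) (envCounit k B)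
          (TensorProduct.map (gen k B n) (gen k B n) t) =
          TensorProduct.map (gen k B n) LinearMap.id
            ((counit : B →ₗ[k] k).lTensor B t) := fun t => by
        induction t with
        | zero => simp
        | add x y hx hy => simp only [map_add, hx, hy]
        | tmul x y => simp [envCounit_gen]
      refine (congrArg _ (envComul_gen k B n b)).trans ((h1 _).trans ?_)
      rw [← twisted_counit k B n, (twistedCoalgebra k B n).lTensor_counit_comul]
      simp)

theorem comul_gen (n : ℕ) (b : B) : comul (R := k) (gen k B n b) =
    TensorProduct.map (gen k B n) (gen k B n) ((twistedCoalgebra k B n).comul b) :=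
  envComul_gen k B n b

theorem counit_gen (n : ℕ) (b : B) : counit (R := k) (gen k B n b) = counit (R := k) b :=
  envCounit_gen k B n b

theorem isFamily_antipode : IsFamily (fun n =>
    (MulOpposite.opLinearEquiv k).toLinearMap ∘ₗ gen k B (n + 1)) where
  one n := by simp [(isFamily_gen k B).one]
  mul n a b := by
    have := (isFamily_gen k B).mul (n + 1) b a
    change MulOpposite.op (gen k B (n + 1) (twistedMul k B (n + 1) b a)) = _
    rw [this]
    rfl
  left n b := by
    have := (isFamily_gen k B).right (n + 1) b
    have h : ∀ t : B ⊗[k] B, LinearMap.mul' k (HopfEnvelope k B)ᵐᵒᵖ (TensorProduct.map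
        ((MulOpposite.opLinearEquiv k).toLinearMap ∘ₗ gen k B (n + 1 + 1))
        ((MulOpposite.opLinearEquiv k).toLinearMap ∘ₗ gen k B (n + 1)) t) =
        MulOpposite.op (LinearMap.mul' k _ (TensorProduct.map (gen k B (n + 1))
          (gen k B (n + 1 + 1)) (TensorProduct.comm k B B t))) := fun t => by
      induction t with
      | zero => simp
      | add x y hx hy => simp only [map_add, hx, hy, MulOpposite.op_add]
      | tmul x y => simp
    rw [h, ← twisted_comul_succ, this, twisted_counit, twisted_counit]
    rfl
  right n b := by
    have := (isFamily_gen k B).left (n + 1) b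
    have h : ∀ t : B ⊗[k] B, LinearMap.mul' k (HopfEnvelope k B)ᵐᵒᵖ (TensorProduct.map
        ((MulOpposite.opLinearEquiv k).toLinearMap ∘ₗ gen k B (n + 1))
        ((MulOpposite.opLinearEquiv k).toLinearMap ∘ₗ gen k B (n + 1 + 1)) t) =
        MulOpposite.op (LinearMap.mul' k _ (TensorProduct.map (gen k B (n + 1 + 1))
          (gen k B (n + 1)) (TensorProduct.comm k B B t))) := fun t => by
      induction t with
      | zero => simp
      | add x y hx hy => simp only [map_add, hx, hy, MulOpposite.op_add]
      | tmul x y => simp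
    rw [h, ← twisted_comul_succ, this, twisted_counit, twisted_counit]
    rfl

/-- The antipode `b⁽ⁿ⁾ ↦ b⁽ⁿ⁺¹⁾` as an algebra map to the opposite algebra. -/
def antipodeOp : HopfEnvelope k B →ₐ[k] (HopfEnvelope k B)ᵐᵒᵖ :=
  liftFamily _ (isFamily_antipode k B)

/-- The antipode `b⁽ⁿ⁾ ↦ b⁽ⁿ⁺¹⁾`. -/
def envAntipode : HopfEnvelope k B →ₗ[k] HopfEnvelope k B :=
  (MulOpposite.opLinearEquiv k).symm.toLinearMap ∘ₗ (antipodeOp k B).toLinearMap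

theorem envAntipode_gen (n : ℕ) (b : B) :
    envAntipode k B (gen k B n b) = gen k B (n + 1) b :=
  congrArg MulOpposite.unop (liftFamily_gen _ (isFamily_antipode k B) n b)

theorem envAntipode_mul (x y : HopfEnvelope k B) :
    envAntipode k B (x * y) = envAntipode k B y * envAntipode k B x :=
  congrArg MulOpposite.unop (map_mul (antipodeOp k B) x y)

theorem envAntipode_algebraMap (c : k) :
    envAntipode k B (algebraMap k _ c) = algebraMap k _ c :=
  congrArg MulOpposite.unop ((antipodeOp k B).commutes c)

/-- The Hopf envelope is a Hopf algebra. -/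
instance : HopfAlgebra k (HopfEnvelope k B) where
  antipode := envAntipode k B
  mul_antipode_rTensor_comul := by
    refine LinearMap.ext fun x => ?_
    simp only [LinearMap.comp_apply]
    induction x using induction with
    | hk c => simp [Algebra.TensorProduct.algebraMap_apply, envAntipode_algebraMap]
    | ha x y hx hy => simp only [map_add, hx, hy]
    | hg n b =>
      have h : ∀ t : B ⊗[k] B, (envAntipode k B).rTensor _
          (TensorProduct.map (gen k B n) (gen k B n) t) =
          TensorProduct.map (gen k B (n + 1)) (gen k B n) t := fun t => by
        induction t with
        | zero => simp
        | add x y hx hy => simp only [map_add, hx, hy]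
        | tmul x y => simp [envAntipode_gen]
      rw [comul_gen, h, (isFamily_gen k B).left n b, twisted_counit, counit_gen]
      rfl
    | hm x y hx hy =>
      have h : ∀ s t : HopfEnvelope k B ⊗[k] HopfEnvelope k B,
          LinearMap.mul' k _ ((envAntipode k B).rTensor _ (s * t)) = LinearMap.mul' k _
            (TensorProduct.map (envAntipode k B) (LinearMap.mul k _
              (LinearMap.mul' k _ ((envAntipode k B).rTensor _ s))) t) := fun s t => by
        induction s with
        | zero => simp
        | add x y hx hy =>
          simp only [add_mul, map_add, hx, hy, TensorProduct.map_add_right,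
            LinearMap.add_apply]
        | tmul x y =>
          induction t with
          | zero => simp
          | add x y hx hy => simp only [mul_add, map_add, hx, hy]
          | tmul z w => simp [envAntipode_mul, mul_assoc]
      have h2 : ∀ (c : k) (t : HopfEnvelope k B ⊗[k] HopfEnvelope k B), LinearMap.mul' k _
            (TensorProduct.map (envAntipode k B) (LinearMap.mul k _ (algebraMap k _ c)) t) =
            c • LinearMap.mul' k _ ((envAntipode k B).rTensor _ t) := fun c t => by
        induction t with
        | zero => simp
        | add x y hx hy => simp only [map_add, hx, hy, smul_add]
        | tmul x y => simp [Algebra.algebraMap_eq_smul_one]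
      rw [Bialgebra.comul_mul, h, hx, Algebra.linearMap_apply, h2, hy, Bialgebra.counit_mul,
        Algebra.linearMap_apply, Algebra.linearMap_apply, map_mul, Algebra.smul_def]
  mul_antipode_lTensor_comul := by
    refine LinearMap.ext fun x => ?_
    simp only [LinearMap.comp_apply]
    induction x using induction with
    | hk c =>
      have h1 : envAntipode k B 1 = 1 := by simpa using envAntipode_algebraMap k B 1
      simp [Algebra.TensorProduct.algebraMap_apply, h1]
    | ha x y hx hy => simp only [map_add, hx, hy]
    | hg n b =>
      have h : ∀ t : B ⊗[k] B, (envAntipode k B).lTensor _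
          (TensorProduct.map (gen k B n) (gen k B n) t) =
          TensorProduct.map (gen k B n) (gen k B (n + 1)) t := fun t => by
        induction t with
        | zero => simp
        | add x y hx hy => simp only [map_add, hx, hy]
        | tmul x y => simp [envAntipode_gen]
      rw [comul_gen, h, (isFamily_gen k B).right n b, twisted_counit, counit_gen]
      rfl
    | hm x y hx hy =>
      have h : ∀ s t : HopfEnvelope k B ⊗[k] HopfEnvelope k B,
          LinearMap.mul' k _ ((envAntipode k B).lTensor _ (s * t)) = LinearMap.mul' k _
            (TensorProduct.map ((LinearMap.mul k _).flip
              (LinearMap.mul' k _ ((envAntipode k B).lTensor _ t))) (envAntipode k B) s) :=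
          fun s t => by
        induction t with
        | zero => simp
        | add x y hx hy =>
          simp only [mul_add, map_add, hx, hy, TensorProduct.map_add_left,
            LinearMap.add_apply]
        | tmul x y =>
          induction s with
          | zero => simp
          | add x y hx hy => simp only [add_mul, map_add, hx, hy]
          | tmul z w => simp [envAntipode_mul, mul_assoc]
      have h2 : ∀ (c : k) (t : HopfEnvelope k B ⊗[k] HopfEnvelope k B), LinearMap.mul' k _
            (TensorProduct.map ((LinearMap.mul k _).flip (algebraMap k _ c)) (envAntipode k B) t) =
            c • LinearMap.mul' k _ ((envAntipode k B).lTensor _ t) := fun c t => by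
        induction t with
        | zero => simp
        | add x y hx hy => simp only [map_add, hx, hy, smul_add]
        | tmul x y => simp [Algebra.algebraMap_eq_smul_one]
      rw [Bialgebra.comul_mul, h, hy, Algebra.linearMap_apply, h2, hx, Bialgebra.counit_mul,
        Algebra.linearMap_apply, Algebra.linearMap_apply, map_mul, Algebra.smul_def,
        Algebra.commutes]

theorem antipode_gen (n : ℕ) (b : B) :
    HopfAlgebra.antipode k (gen k B n b) = gen k B (n + 1) b := envAntipode_gen k B n b

/-- The canonical map `b ↦ b⁽⁰⁾` from a bialgebra to its Hopf envelope. -/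
def of : B →ₐc[k] HopfEnvelope k B :=
  BialgHom.ofAlgHom
    (AlgHom.ofLinearMap (gen k B 0) ((isFamily_gen k B).one 0) ((isFamily_gen k B).mul 0))
    (by ext b; exact counit_gen k B 0 b)
    (by ext b; exact (comul_gen k B 0 b).symm)

theorem of_apply (b : B) : of k B b = gen k B 0 b := rfl

end HopfEnvelope

end Envelope

section Universal

theorem map_antipode {k : Type u} [Field k] {H : Type v} [Ring H] [HopfAlgebra k H]
    {X : Type w} [Ring X] [HopfAlgebra k X] (g : H →ₐc[k] X) (a : H) :
    g (HopfAlgebra.antipode k a) = HopfAlgebra.antipode k (g a) := by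
  have h1 : toConv ((g : H →ₐ[k] X).toLinearMap ∘ₗ HopfAlgebra.antipode k) *
      toConv ((g : H →ₐ[k] X).toLinearMap) = 1 := by
    ext a
    rw [(ℛ k a).convMul_apply]
    have := congrArg g (HopfAlgebra.sum_antipode_mul_eq_algebraMap_counit (ℛ k a))
    rw [map_sum] at this
    have h := (g : H →ₐ[k] X).commutes (counit a)
    simpa using this.trans h
  have h2 : toConv ((g : H →ₐ[k] X).toLinearMap) *
      toConv (HopfAlgebra.antipode k ∘ₗ (g : H →ₐ[k] X).toLinearMap) = 1 := by
    ext a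
    rw [(ℛ k a).convMul_apply]
    have := HopfAlgebra.sum_mul_antipode_eq_algebraMap_counit ((ℛ k a).induced g)
    simpa using this
  exact congrArg (fun u : WithConv (H →ₗ[k] X) => u.ofConv a) (left_inv_eq_right_inv h1 h2)

theorem comul_antipode {k : Type u} [Field k] {X : Type w} [Ring X] [HopfAlgebra k X] (a : X) :
    comul (R := k) (HopfAlgebra.antipode k a) =
      TensorProduct.map (HopfAlgebra.antipode k) (HopfAlgebra.antipode k)
        (TensorProduct.comm k X X (comul a)) := by
  have h1 : ConvOne inferInstance (HopfAlgebra.antipode k : X →ₗ[k] X) LinearMap.id :=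
    fun b => HopfAlgebra.mul_antipode_rTensor_comul_apply b
  have h2 := (convOne_iff _ _).1 (convOne_comul' h1)
  rw [TensorProduct.map_id] at h2
  have h3 := LinearMap.comul_right_inv (R := k) (C := X)
  exact congrArg (fun u : WithConv (X →ₗ[k] X ⊗[k] X) => u.ofConv a)
    (left_inv_eq_right_inv h2 h3).symm

namespace HopfEnvelope

variable {k : Type u} [Field k] {B : Type v} [Ring B] [Bialgebra k B]
  {X : Type w} [Ring X] [HopfAlgebra k X]

/-- The linear maps `Sⁿ ∘ f`. -/
def iterAntipode (f : B →ₐc[k] X) : ℕ → B →ₗ[k] X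
  | 0 => (f : B →ₐ[k] X).toLinearMap
  | n + 1 => HopfAlgebra.antipode k ∘ₗ iterAntipode f n

theorem comul_iterAntipode (f : B →ₐc[k] X) (n : ℕ) (b : B) :
    comul (R := k) (iterAntipode f n b) =
      TensorProduct.map (iterAntipode f n) (iterAntipode f n)
        ((twistedCoalgebra k B n).comul b) := by
  induction n generalizing b with
  | zero => exact (CoalgHomClass.map_comp_comul_apply f b).symm
  | succ n ih =>
    rw [twisted_comul_succ]
    simp only [iterAntipode, LinearMap.comp_apply]
    rw [comul_antipode, ih]
    generalize (twistedCoalgebra k B n).comul b = t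
    induction t with
    | zero => simp
    | add x y hx hy => simp only [map_add, hx, hy]
    | tmul x y => simp

theorem counit_iterAntipode (f : B →ₐc[k] X) (n : ℕ) (b : B) :
    counit (R := k) (iterAntipode f n b) = counit (R := k) b := by
  induction n with
  | zero => exact CoalgHomClass.counit_comp_apply f b
  | succ n ih => exact (HopfAlgebra.counit_antipode _).trans ih

theorem isFamily_iterAntipode (f : B →ₐc[k] X) : IsFamily (iterAntipode f) where
  one n := by
    induction n with
    | zero => exact map_one f
    | succ n ih => simp [iterAntipode, ih]
  mul n a b := by
    induction n generalizing a b with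
    | zero => exact map_mul f a b
    | succ n ih =>
      change HopfAlgebra.antipode k (iterAntipode f n (twistedMul k B n b a)) = _
      rw [ih, HopfAlgebra.antipode_mul_antidistrib]
      rfl
  left n b := by
    have h : ∀ t : B ⊗[k] B, TensorProduct.map (iterAntipode f (n + 1)) (iterAntipode f n) t =
        (HopfAlgebra.antipode k).rTensor X
          (TensorProduct.map (iterAntipode f n) (iterAntipode f n) t) := fun t => by
      induction t with
      | zero => simp
      | add x y hx hy => simp only [map_add, hx, hy]
      | tmul x y => rfl
    rw [h, ← comul_iterAntipode, HopfAlgebra.mul_antipode_rTensor_comul_apply,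
      counit_iterAntipode, twisted_counit]
  right n b := by
    have h : ∀ t : B ⊗[k] B, TensorProduct.map (iterAntipode f n) (iterAntipode f (n + 1)) t =
        (HopfAlgebra.antipode k).lTensor X
          (TensorProduct.map (iterAntipode f n) (iterAntipode f n) t) := fun t => by
      induction t with
      | zero => simp
      | add x y hx hy => simp only [map_add, hx, hy]
      | tmul x y => rfl
    rw [h, ← comul_iterAntipode, HopfAlgebra.mul_antipode_lTensor_comul_apply,
      counit_iterAntipode, twisted_counit]

/-- The universal property of the Hopf envelope: every bialgebra map from `B` to a Hopf algebra
factors uniquely through the canonical map `B → H(B)`. -/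
theorem existsUnique_lift (f : B →ₐc[k] X) :
    ∃! g : HopfEnvelope k B →ₐc[k] X, g.comp (of k B) = f := by
  refine ⟨BialgHom.ofAlgHom (liftFamily _ (isFamily_iterAntipode f)) ?_ ?_, ?_, ?_⟩
  · refine hom_ext fun n b => ?_
    refine (congrArg (counit (R := k)) (liftFamily_gen _ (isFamily_iterAntipode f) n b)).trans ?_
    exact (counit_iterAntipode f n b).trans (counit_gen k B n b).symm
  · refine hom_ext fun n b => ?_
    have h : ∀ t : B ⊗[k] B, Algebra.TensorProduct.map
        (liftFamily _ (isFamily_iterAntipode f)) (liftFamily _ (isFamily_iterAntipode f))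
        (TensorProduct.map (gen k B n) (gen k B n) t) =
        TensorProduct.map (iterAntipode f n) (iterAntipode f n) t := fun t => by
      induction t with
      | zero => simp
      | add x y hx hy => simp only [map_add, hx, hy]
      | tmul x y => simp
    refine (congrArg _ (comul_gen k B n b)).trans ((h _).trans ?_)
    refine (comul_iterAntipode f n b).symm.trans ?_
    exact congrArg (comul (R := k)) (liftFamily_gen _ (isFamily_iterAntipode f) n b).symm
  · ext b
    exact liftFamily_gen _ (isFamily_iterAntipode f) 0 b
  · intro g hg
    apply BialgHom.coe_toAlgHom_injective
    refine hom_ext fun n b => ?_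
    refine Eq.trans ?_ (liftFamily_gen _ (isFamily_iterAntipode f) n b).symm
    induction n with
    | zero => exact congrArg (fun u : B →ₐc[k] X => u b) hg
    | succ n ih =>
      rw [← antipode_gen]
      exact (map_antipode g _).trans (congrArg _ ih)

end HopfEnvelope

end Universal

section Cofree

variable (k : Type u) [Field k] {A : Type v} [Ring A] [Algebra k A]

/-- `π : B → A` is the cofree bialgebra on the algebra `A`: every algebra map from a bialgebra to
`A` factors through `π` by a unique map of bialgebras. (The bialgebras are those in `Type w`.) -/
def IsCofreeBialgebra {B : Type x} [Ring B] [Bialgebra k B] (π : B →ₐ[k] A) : Prop :=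
  ∀ (X : Type w) [Ring X] [Bialgebra k X] (f : X →ₐ[k] A),
    ∃! g : X →ₐc[k] B, π.comp (g : X →ₐ[k] B) = f

/-- `π : H → A` is the cofree Hopf algebra on the algebra `A`: every algebra map from a Hopf
algebra to `A` factors through `π` by a unique map of Hopf algebras. (A map of Hopf algebras is a
map of the underlying bialgebras. The Hopf algebras are those in `Type w`.) -/
def IsCofreeHopfAlgebra {H : Type x} [Ring H] [HopfAlgebra k H] (π : H →ₐ[k] A) : Prop :=
  ∀ (X : Type w) [Ring X] [HopfAlgebra k X] (f : X →ₐ[k] A),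
    ∃! g : X →ₐc[k] H, π.comp (g : X →ₐ[k] H) = f

end Cofree

section Dual

variable (k : Type u) [Field k] (A : Type v) [Ring A] [Algebra k A] [FiniteDimensional k A]

/-- The bialgebra `T(A^*)`. -/
abbrev DualTensor : Type (max u v) := TensorAlgebra k (Module.Dual k A)

/-- The finite dual `H(T(A^*))° → T(A^*)°` of the canonical map from the bialgebra `T(A^*)` to its
Hopf envelope. -/
def dualEnvelopeMap :
    FiniteDual k (HopfEnvelope k (DualTensor k A)) →ₐc[k] FiniteDual k (DualTensor k A) :=
  FiniteDual.map (HopfEnvelope.of k (DualTensor k A))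

end Dual

end HopfDuality

end

/-! The finite dual is adjoint to itself: for bialgebras `R` and `X`, bialgebra maps `R → X°` and
bialgebra maps `X → R°` are both the same thing as a bialgebra pairing `R × X → k`, because the
axioms of a pairing are symmetric in the two arguments (`IsBialgebraPairing.flip`). The one point
that is not formal is finiteness: a pairing a priori gives functionals in `R^*` only, and
`IsBialgebraPairing.flip_apply_mem` shows that they lie in `R°`. The reason is the fundamental
theorem of coalgebras in disguise: `(Δ ⊗ id)Δ(x)` involves only finitely many middle factors.

Granting this, bialgebra maps `X → T(A^*)°` are pairings of `T(A^*)` with `X`. Such a pairing is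
multiplicative in the first variable, so it is determined by its restriction to `A^* × X`. An
algebra map `f : X → A` gives the restriction `(θ, x) ↦ θ(f(x))`, which extends to `T(A^*)` by the
universal property of the tensor algebra applied to the convolution algebra `X^*`. The extension is
a pairing because `f` is multiplicative and unital (`isBialgebraPairing_tensorPairing`). This is the
cofree bialgebra.

If `X` is a Hopf algebra, then so is `X°`. Hence the transpose `T(A^*) → X°` of a map `X → T(A^*)°`
factors uniquely through the Hopf envelope, and transposing back gives a unique factorization of `X
→ T(A^*)°` through `ι°` (`FiniteDual.existsUnique_lift_envelope`). This is the cofree Hopf algebra.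
The description of the canonical map is then a consequence of the uniqueness of universal objects
and of maps into them. -/

noncomputable section

namespace HopfDuality

/-! ### Bialgebra pairings and the self-adjointness of the finite dual. -/

section BialgebraPairing

variable {k : Type u} [Field k] {R : Type v} [Ring R] [Bialgebra k R]
  {X : Type w} [Ring X] [Bialgebra k X]

/-- A bilinear form on `R × X` for which the multiplication and unit of each of the bialgebras are
dual to the comultiplication and counit of the other. -/
structure IsBialgebraPairing (β : R →ₗ[k] X →ₗ[k] k) : Prop where
  one_left : ∀ x, β 1 x = counit x
  mul_left : ∀ r s x,
    β (r * s) x = LinearMap.mul' k k (TensorProduct.map (β r) (β s) (comul x))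
  one_right : ∀ r, β r 1 = counit r
  mul_right : ∀ r x y,
    β r (x * y) = LinearMap.mul' k k (TensorProduct.map (β.flip x) (β.flip y) (comul r))

namespace IsBialgebraPairing

variable {β : R →ₗ[k] X →ₗ[k] k}

/-- The left and the right axioms change places. This symmetry lets each construction of a map `R →
X°` serve also for maps `X → R°`. -/
theorem flip (h : IsBialgebraPairing β) : IsBialgebraPairing β.flip where
  one_left := h.one_right
  mul_left x y r := h.mul_right r x y
  one_right := h.one_left
  mul_right x r s := h.mul_left r s x

theorem mul_left_repr (h : IsBialgebraPairing β) (r s : R) {x : X} {ι : Type*}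
    (p : Coalgebra.Repr k x ι) :
    β (r * s) x = ∑ i ∈ p.index, β r (p.left i) * β s (p.right i) := by
  rw [h.mul_left, ← p.eq]
  simp

/-- The functionals `β(·, x)` lie in the finite dual: `β(s · t, x) = ∑ β(s, x₁) β(·, x₂) β(t, x₃)`
vanishes on a subspace of finite codimension that does not depend on `s` and `t`. -/
theorem flip_apply_mem (h : IsBialgebraPairing β) (x : X) :
    β.flip x ∈ finiteDualSubmodule k R := by
  classical
  -- The largest two-sided ideal contained in the kernel of `β(·, x)`.
  let I : Ideal R :=
    { carrier := {r | ∀ s t, β (s * r * t) x = 0}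
      zero_mem' := by simp
      add_mem' := fun {a b} ha hb s t => by
        rw [mul_add, add_mul, map_add, LinearMap.add_apply, ha, hb, add_zero]
      smul_mem' := fun c a ha s t => by
        rw [smul_eq_mul, ← mul_assoc]
        exact ha _ _ }
  have hI : I.IsTwoSided := ⟨fun b ha s t => by
    rw [← mul_assoc, mul_assoc _ b]
    exact ha _ _⟩
  refine ⟨I, hI, ?_, fun r hr => ?_⟩
  -- `F` is the finite set of middle factors `x₂` in a chosen expression `∑ x₁ ⊗ x₂ ⊗ x₃`, where the
  -- second tensor factor of `Δ(x)` has been expanded. If `r` pairs to zero with all of `F`, then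
  -- `β(s r t, x) = ∑ β(s, x₁) β(r, x₂) β(t, x₃)` vanishes for all `s` and `t`. So `ker L` lies in
  -- `I`, and `R ⧸ I` is a quotient of `R ⧸ ker L`, which embeds in `k^F`.
  · let F : Finset X := (ℛ k x).index.biUnion fun i =>
      (ℛ k ((ℛ k x).right i)).index.image (ℛ k ((ℛ k x).right i)).left
    let L : R →ₗ[k] F → k := LinearMap.pi fun y => β.flip y
    have hL : LinearMap.ker L ≤ LinearMap.ker (Ideal.Quotient.mkₐ k I).toLinearMap := by
      intro r hr
      refine Ideal.Quotient.eq_zero_iff_mem.2 fun s t => ?_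
      rw [mul_assoc, h.mul_left_repr _ _ (ℛ k x)]
      refine Finset.sum_eq_zero fun i hi => ?_
      rw [h.mul_left_repr _ _ (ℛ k ((ℛ k x).right i)), Finset.sum_eq_zero, mul_zero]
      intro j hj
      have hy := congrFun (LinearMap.mem_ker.1 hr) ⟨_, Finset.mem_biUnion.2
        ⟨i, hi, Finset.mem_image_of_mem (ℛ k ((ℛ k x).right i)).left hj⟩⟩
      have hy' : β r ((ℛ k ((ℛ k x).right i)).left j) = 0 := hy
      rw [hy', zero_mul]
    have : FiniteDimensional k (R ⧸ LinearMap.ker L) := Module.Finite.equiv L.quotKerEquivRange.symm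
    refine Module.Finite.of_surjective ((LinearMap.ker L).liftQ _ hL) fun y => ?_
    obtain ⟨r, rfl⟩ := Ideal.Quotient.mk_surjective y
    exact ⟨Submodule.Quotient.mk r, rfl⟩
  · simpa using hr 1 1

/-- The linear map `R → X°`, `r ↦ β(r, ·)`. -/
def toFiniteDualₗ (h : IsBialgebraPairing β) : R →ₗ[k] FiniteDual k X :=
  LinearMap.codRestrict (finiteDualSubmodule k X) β h.flip.flip_apply_mem

/-- The bialgebra map `R → X°`, `r ↦ β(r, ·)`. -/
def toFiniteDual (h : IsBialgebraPairing β) : R →ₐc[k] FiniteDual k X :=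
  BialgHom.ofAlgHom
    (AlgHom.ofLinearMap h.toFiniteDualₗ
      (by
        ext x
        exact h.one_left x)
      (by
        intro r s
        ext x
        rw [FiniteDual.incl_mul_repr _ _ (ℛ k x)]
        exact h.mul_left_repr r s (ℛ k x)))
    (by
      ext r
      exact h.one_right r)
    (by
      ext r
      -- Elements of `X° ⊗ X°` are separated by their values on the tensors `x ⊗ y`, and on these
      -- values the compatibility with `Δ` is the axiom `mul_right`.
      apply FiniteDual.pair_injective
      ext x y
      have : ∀ t : R ⊗[k] R,
          FiniteDual.pair k X (TensorProduct.map h.toFiniteDualₗ h.toFiniteDualₗ t) (x ⊗ₜ y) =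
            LinearMap.mul' k k (TensorProduct.map (β.flip x) (β.flip y) t) := fun t => by
        induction t with
        | zero => simp
        | add x y hx hy => simp only [map_add, LinearMap.add_apply, hx, hy]
        | tmul r s => rfl
      refine (this _).trans ((h.mul_right r x y).symm.trans ?_)
      exact (FiniteDual.pair_comul (h.toFiniteDualₗ r) x y).symm)

end IsBialgebraPairing

/-- Converse of `IsBialgebraPairing.toFiniteDual`. The product of `X°` is convolution, so the left
axioms say that `g` is an algebra map; the coproduct of `X°` is dual to the product of `X` and its
counit is evaluation at `1`, so the right axioms say that `g` is a coalgebra map. -/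
theorem FiniteDual.isBialgebraPairing (g : R →ₐc[k] FiniteDual k X) :
    IsBialgebraPairing (FiniteDual.incl k X ∘ₗ (g : R →ₐ[k] FiniteDual k X).toLinearMap) where
  one_left x := by
    have : g 1 = 1 := map_one g
    exact (congrArg (fun f => FiniteDual.incl k X f x) this).trans (FiniteDual.incl_one x)
  mul_left r s x := by
    have : g (r * s) = g r * g s := map_mul g r s
    exact congrArg (fun f => FiniteDual.incl k X f x) this
  one_right r := CoalgHomClass.counit_comp_apply g r
  mul_right r x y := by
    have h : ∀ t : R ⊗[k] R, FiniteDual.pair k X (TensorProduct.map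
        (g : R →ₐ[k] FiniteDual k X).toLinearMap (g : R →ₐ[k] FiniteDual k X).toLinearMap t)
          (x ⊗ₜ y) = LinearMap.mul' k k (TensorProduct.map
        ((FiniteDual.incl k X ∘ₗ (g : R →ₐ[k] FiniteDual k X).toLinearMap).flip x)
        ((FiniteDual.incl k X ∘ₗ (g : R →ₐ[k] FiniteDual k X).toLinearMap).flip y) t) := fun t => by
      induction t with
      | zero => simp
      | add x y hx hy => simp only [map_add, LinearMap.add_apply, hx, hy]
      | tmul r s => rfl
    rw [← h]
    refine (FiniteDual.pair_comul (g r) x y).symm.trans ?_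
    exact congrArg (fun t => FiniteDual.pair k X t (x ⊗ₜ y))
      (CoalgHomClass.map_comp_comul_apply g r).symm

/-- The bialgebra map `X → R°` that corresponds to a bialgebra map `R → X°`. -/
def FiniteDual.transpose (g : R →ₐc[k] FiniteDual k X) : X →ₐc[k] FiniteDual k R :=
  (FiniteDual.isBialgebraPairing g).flip.toFiniteDual

/-- A map and its transpose have the same underlying bilinear form up to the order of the arguments,
so either one determines the other. -/
theorem FiniteDual.transpose_injective :
    Function.Injective (FiniteDual.transpose (k := k) (R := R) (X := X)) := by
  intro g g' h
  ext r x
  exact congrArg (fun p : X →ₐc[k] FiniteDual k R => FiniteDual.incl k R (p x) r) h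

/-- Naturality of the adjunction: both sides send `x` to the functional `s ↦ g(φ(s))(x)`. -/
theorem FiniteDual.map_comp_transpose {S : Type x} [Ring S] [Bialgebra k S] (φ : S →ₐc[k] R)
    (g : R →ₐc[k] FiniteDual k X) :
    (FiniteDual.map φ).comp (FiniteDual.transpose g) = FiniteDual.transpose (g.comp φ) := rfl

end BialgebraPairing

/-! ### The finite dual of the Hopf envelope. -/

section Hopf

variable {k : Type u} [Field k] {B : Type v} [Ring B] [Bialgebra k B]
  {X : Type w} [Ring X] [HopfAlgebra k X]

/-- A bialgebra map from a Hopf algebra to `B°` factors uniquely through the finite dual of the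
Hopf envelope of `B`. -/
theorem FiniteDual.existsUnique_lift_envelope (g : X →ₐc[k] FiniteDual k B) :
    ∃! g' : X →ₐc[k] FiniteDual k (HopfEnvelope k B),
      (FiniteDual.map (HopfEnvelope.of k B)).comp g' = g := by
  -- The transpose is a map `B → X°`, and `X°` is a Hopf algebra because `X` is one, so the
  -- universal property of the envelope applies.
  obtain ⟨L, hL, huniq⟩ := HopfEnvelope.existsUnique_lift (FiniteDual.transpose g)
  refine ⟨FiniteDual.transpose L, ?_, fun g' hg' => ?_⟩
  · change (FiniteDual.map _).comp _ = _
    rw [FiniteDual.map_comp_transpose, hL]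
    -- Transposing twice gives back `g` by definition.
    rfl
  · apply FiniteDual.transpose_injective
    -- By naturality, the transpose of `hg'` says that `transpose g'` extends `transpose g` to the
    -- envelope, so it is `L`.
    exact huniq _ (congrArg FiniteDual.transpose hg')

end Hopf

/-! ### The pairing of `T(A^*)` with a bialgebra over `A`. -/

section TensorPairing

variable {k : Type u} [Field k] {A : Type v} [Ring A] [Algebra k A]
  {X : Type w} [Ring X] [Bialgebra k X]

/-- The algebra map from `T(A^*)` to the convolution algebra `X^*` that extends `θ ↦ θ ∘ f`. -/
def tensorToConv (f : X →ₐ[k] A) :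
    TensorAlgebra k (Module.Dual k A) →ₐ[k] WithConv (X →ₗ[k] k) :=
  TensorAlgebra.lift k ((WithConv.linearEquiv k (X →ₗ[k] k)).symm.toLinearMap ∘ₗ
    f.toLinearMap.dualMap)

/-- The pairing of `T(A^*)` with `X` that extends `(θ, x) ↦ θ(f(x))`. -/
def tensorPairing (f : X →ₐ[k] A) : TensorAlgebra k (Module.Dual k A) →ₗ[k] X →ₗ[k] k :=
  (WithConv.linearEquiv k (X →ₗ[k] k)).toLinearMap ∘ₗ (tensorToConv f).toLinearMap

theorem tensorPairing_ι (f : X →ₐ[k] A) (θ : Module.Dual k A) (x : X) :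
    tensorPairing f (TensorAlgebra.ι k θ) x = θ (f x) := by
  simp [tensorPairing, tensorToConv]

theorem tensorPairing_one (f : X →ₐ[k] A) (x : X) : tensorPairing f 1 x = counit x :=
  congrArg (fun u : WithConv (X →ₗ[k] k) => u.ofConv x) (map_one (tensorToConv f))

theorem tensorPairing_mul (f : X →ₐ[k] A) (s t : TensorAlgebra k (Module.Dual k A)) (x : X) :
    tensorPairing f (s * t) x =
      LinearMap.mul' k k (TensorProduct.map (tensorPairing f s) (tensorPairing f t) (comul x)) :=
  congrArg (fun u : WithConv (X →ₗ[k] k) => u.ofConv x) (map_mul (tensorToConv f) s t)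

theorem tensorPairing_mul_repr (f : X →ₐ[k] A) (s t : TensorAlgebra k (Module.Dual k A)) {x : X}
    {ι : Type*} (p : Coalgebra.Repr k x ι) :
    tensorPairing f (s * t) x =
      ∑ i ∈ p.index, tensorPairing f s (p.left i) * tensorPairing f t (p.right i) := by
  rw [tensorPairing_mul, ← p.eq]
  simp

/-- The left axioms hold because `tensorToConv f` is an algebra map to the convolution algebra. The
right axioms are proved by induction on the element of `T(A^*)`. On `A^*`, whose coalgebra structure
is dual to the algebra `A`, they express `f(1) = 1` and `f(xy) = f(x)f(y)`. They pass to products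
because the counit and comultiplication of `T(A^*)` are algebra maps. -/
theorem isBialgebraPairing_tensorPairing [FiniteDimensional k A] (f : X →ₐ[k] A) :
    IsBialgebraPairing (tensorPairing f) where
  one_left := tensorPairing_one f
  mul_left := tensorPairing_mul f
  one_right t := by
    induction t using TensorAlgebra.induction with
    | algebraMap c =>
      simp [Algebra.algebraMap_eq_smul_one, tensorPairing_one]
    | ι θ => rw [tensorPairing_ι, map_one, tensor_counit_ι, dual_counit]
    | mul s t hs ht =>
      rw [tensorPairing_mul, Bialgebra.comul_one, Algebra.TensorProduct.one_def,
        Bialgebra.counit_mul]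
      simp [hs, ht]
    | add s t hs ht => simp only [map_add, LinearMap.add_apply, hs, ht]
  mul_right t x y := by
    -- In the product case the hypotheses are needed at the components of `Δ(x)` and `Δ(y)`, so `x`
    -- and `y` must vary.
    induction t using TensorAlgebra.induction generalizing x y with
    | algebraMap c =>
      simp [Algebra.algebraMap_eq_smul_one, tensorPairing_one, Algebra.TensorProduct.one_def]
    | ι θ =>
      rw [tensorPairing_ι, map_mul, tensor_comul_ι, ← dual_comul]
      induction (comul θ : Module.Dual k A ⊗[k] Module.Dual k A) with
      | zero => simp
      | add x y hx hy => simp only [map_add, LinearMap.add_apply, hx, hy]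
      | tmul θ η => simp [tensorPairing_ι]
    | mul s t hs ht =>
      rw [tensorPairing_mul_repr f s t ((ℛ k x).mul (ℛ k y)), Bialgebra.comul_mul]
      -- The induced pairing of `T ⊗ T` with `X ⊗ X`, where `T = T(A^*)`, is again multiplicative on
      -- the left: `⟨pq, x ⊗ y⟩ = ∑ ⟨p, x₁ ⊗ y₁⟩ ⟨q, x₂ ⊗ y₂⟩`. On pure tensors this exchanges the
      -- two middle scalars.
      have h : ∀ p q : TensorAlgebra k (Module.Dual k A) ⊗[k] TensorAlgebra k (Module.Dual k A),
          LinearMap.mul' k k (TensorProduct.map ((tensorPairing f).flip x)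
            ((tensorPairing f).flip y) (p * q)) =
          ∑ i ∈ ((ℛ k x).mul (ℛ k y)).index,
            LinearMap.mul' k k (TensorProduct.map ((tensorPairing f).flip ((ℛ k x).left i.1))
              ((tensorPairing f).flip ((ℛ k y).left i.2)) p) *
            LinearMap.mul' k k (TensorProduct.map ((tensorPairing f).flip ((ℛ k x).right i.1))
              ((tensorPairing f).flip ((ℛ k y).right i.2)) q) := fun p q => by
        induction p with
        | zero => simp
        | add p p' hp hp' =>
          simp only [map_add, add_mul, hp, hp', Finset.sum_add_distrib]
        | tmul a b =>
          induction q with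
          | zero => simp
          | add q q' hq hq' =>
            simp only [map_add, mul_add, hq, hq', Finset.sum_add_distrib]
          | tmul c d =>
            simp only [Algebra.TensorProduct.tmul_mul_tmul, TensorProduct.map_tmul,
              LinearMap.mul'_apply, LinearMap.flip_apply, tensorPairing_mul_repr f _ _ (ℛ k x),
              tensorPairing_mul_repr f _ _ (ℛ k y), Finset.sum_mul_sum]
            rw [← Finset.sum_product']
            exact Finset.sum_congr rfl fun i _ => mul_mul_mul_comm _ _ _ _
      rw [h]
      refine Finset.sum_congr rfl fun i _ => ?_
      rw [← hs, ← ht]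
      rfl
    | add s t hs ht => simp only [map_add, LinearMap.add_apply, hs, ht]

end TensorPairing

/-! ### The cofree bialgebra and the cofree Hopf algebra. -/

section Cofree

variable (k : Type u) [Field k] (A : Type v) [Ring A] [Algebra k A]

/-- The factorization is the map `X → T(A^*)°` given by `tensorPairing f`. For uniqueness, a map
over `A` has its pairing prescribed on `A^* × X`, and multiplicativity in the first variable
propagates this to all of `T(A^*)`. -/
theorem isCofreeBialgebra_dualTensorEval [FiniteDimensional k A] :
    IsCofreeBialgebra.{u, v, w, max u v} k (dualTensorEval k A) := by
  intro X _ _ f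
  refine ⟨(isBialgebraPairing_tensorPairing f).flip.toFiniteDual, ?_, fun g hg => ?_⟩
  · ext x
    -- Linear functionals separate the points of `A`, and `dualTensorEval` is known through its
    -- values under them.
    refine sub_eq_zero.1 ((Module.forall_dual_apply_eq_zero_iff k _).1 fun θ => ?_)
    rw [map_sub, sub_eq_zero]
    exact (dualTensorEval_spec k A _ θ).trans (tensorPairing_ι f θ x)
  · ext x t
    change _ = tensorPairing f t x
    -- The pairing of the competing map `g`, with `T(A^*)` as its first variable.
    have hp := (FiniteDual.isBialgebraPairing g).flip
    induction t using TensorAlgebra.induction generalizing x with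
    | algebraMap c =>
      rw [Algebra.algebraMap_eq_smul_one, map_smul, map_smul, LinearMap.smul_apply,
        tensorPairing_one]
      exact congrArg (c • ·) (hp.one_left x)
    | ι θ =>
      rw [tensorPairing_ι, ← hg]
      exact (dualTensorEval_spec k A (g x) θ).symm
    | mul s t hs ht =>
      rw [tensorPairing_mul_repr f s t (ℛ k x)]
      refine (hp.mul_left_repr s t (ℛ k x)).trans (Finset.sum_congr rfl fun i _ => ?_)
      rw [← hs, ← ht]
      rfl
    | add s t hs ht => rw [map_add, map_add, LinearMap.add_apply, hs, ht]

/-- Two unique factorizations are composed: `f` lifts to `T(A^*)°` as a bialgebra map, and that map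
lifts along `ι°` because its source is a Hopf algebra. -/
theorem isCofreeHopfAlgebra_dualTensorEval [FiniteDimensional k A] :
    IsCofreeHopfAlgebra.{u, v, w, max u v} k ((dualTensorEval k A).comp
      (AlgHomClass.toAlgHom (dualEnvelopeMap k A))) := by
  intro X _ _ f
  obtain ⟨g, hg, hguniq⟩ := isCofreeBialgebra_dualTensorEval k A X f
  obtain ⟨g', hg', huniq⟩ := FiniteDual.existsUnique_lift_envelope g
  refine ⟨g', ?_, fun p hp => huniq p (hguniq _ hp)⟩
  rw [← hg, ← hg']
  rfl

variable {k A}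

/-- Two cofree bialgebras on `A` are isomorphic over `A`. -/
theorem IsCofreeBialgebra.exists_equiv {B C : Type w} [Ring B] [Bialgebra k B] [Ring C]
    [Bialgebra k C] {π : B →ₐ[k] A} {ρ : C →ₐ[k] A} (hπ : IsCofreeBialgebra.{u, v, w, w} k π)
    (hρ : IsCofreeBialgebra.{u, v, w, w} k ρ) : ∃ e : B ≃ₐc[k] C, ∀ b, ρ (e b) = π b := by
  obtain ⟨p, hp, -⟩ := hρ B π
  obtain ⟨q, hq, -⟩ := hπ C ρ
  refine ⟨BialgEquiv.ofBialgHom p q ?_ ?_, fun b => congrArg (fun u : B →ₐ[k] A => u b) hp⟩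
  · refine (hρ C ρ).unique ?_ rfl
    exact (congrArg (fun u : B →ₐ[k] A => u.comp (q : C →ₐ[k] B)) hp).trans hq
  · refine (hπ B π).unique ?_ rfl
    exact (congrArg (fun u : C →ₐ[k] A => u.comp (p : B →ₐ[k] C)) hq).trans hp

/-- Two cofree Hopf algebras on `A` are isomorphic over `A`. -/
theorem IsCofreeHopfAlgebra.exists_equiv {B C : Type w} [Ring B] [HopfAlgebra k B] [Ring C]
    [HopfAlgebra k C] {π : B →ₐ[k] A} {ρ : C →ₐ[k] A} (hπ : IsCofreeHopfAlgebra.{u, v, w, w} k π)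
    (hρ : IsCofreeHopfAlgebra.{u, v, w, w} k ρ) : ∃ e : B ≃ₐc[k] C, ∀ b, ρ (e b) = π b := by
  obtain ⟨p, hp, -⟩ := hρ B π
  obtain ⟨q, hq, -⟩ := hπ C ρ
  refine ⟨BialgEquiv.ofBialgHom p q ?_ ?_, fun b => congrArg (fun u : B →ₐ[k] A => u b) hp⟩
  · refine (hρ C ρ).unique ?_ rfl
    exact (congrArg (fun u : B →ₐ[k] A => u.comp (q : C →ₐ[k] B)) hp).trans hq
  · refine (hπ B π).unique ?_ rfl
    exact (congrArg (fun u : C →ₐ[k] A => u.comp (p : B →ₐ[k] C)) hq).trans hp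

end Cofree

end HopfDuality

end

/-! ### The main theorem and the canonical map between the cofree objects. -/

theorem mainTheorem10 (k : Type u) [Field k] (A : Type v) [Ring A] [Algebra k A]
    [FiniteDimensional k A] :
    HopfDuality.IsCofreeBialgebra.{u, v, w, max u v} k (HopfDuality.dualTensorEval k A) ∧
    HopfDuality.IsCofreeHopfAlgebra.{u, v, w, max u v} k ((HopfDuality.dualTensorEval k A).comp
      (AlgHomClass.toAlgHom (HopfDuality.dualEnvelopeMap k A))) ∧
    ∀ (B H : Type (max u v)) [Ring B] [Bialgebra k B] [Ring H] [HopfAlgebra k H]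
      (πB : B →ₐ[k] A) (πH : H →ₐ[k] A),
      HopfDuality.IsCofreeBialgebra.{u, v, max u v, max u v} k πB →
      HopfDuality.IsCofreeHopfAlgebra.{u, v, max u v, max u v} k πH →
      ∀ φ : H →ₐc[k] B, πB.comp (φ : H →ₐ[k] B) = πH →
        ∃ (β : B ≃ₐc[k] HopfDuality.FiniteDual k (HopfDuality.DualTensor k A))
          (η : H ≃ₐc[k] HopfDuality.FiniteDual k
            (HopfDuality.HopfEnvelope k (HopfDuality.DualTensor k A))),
          (∀ b, HopfDuality.dualTensorEval k A (β b) = πB b) ∧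
          ∀ h, β (φ h) = HopfDuality.dualEnvelopeMap k A (η h) := by

  refine ⟨HopfDuality.isCofreeBialgebra_dualTensorEval k A,
    HopfDuality.isCofreeHopfAlgebra_dualTensorEval k A, ?_⟩
  intro B H _ _ _ _ πB πH hB hH φ hφ
  -- The test objects are taken in `Type (max u v)`, where `B`, `H` and both finite duals live, so
  -- that each universal property can be applied to the other objects.
  have hT := HopfDuality.isCofreeBialgebra_dualTensorEval.{u, v, max u v} k A
  obtain ⟨β, hβ⟩ := hB.exists_equiv hT
  obtain ⟨η, hη⟩ := hH.exists_equiv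
    (HopfDuality.isCofreeHopfAlgebra_dualTensorEval.{u, v, max u v} k A)
  refine ⟨β, η, hβ, fun h => ?_⟩
  -- Both composites are bialgebra maps `H → T(A^*)°` lying over `πH`, so the uniqueness in the
  -- cofree property of `T(A^*)°` identifies them.
  have key : (β : B →ₐc[k] _).comp φ =
      (HopfDuality.dualEnvelopeMap k A).comp (η : H →ₐc[k] _) := by
    refine (hT H πH).unique ?_ ?_
    · rw [← hφ]
      ext y
      exact hβ (φ y)
    · ext y
      exact hη y
  exact congrArg (fun u : H →ₐc[k] _ => u h) key
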